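/- Let $m=(m_1,\dots,m_n)$ be a vector of positive integers, $l(m)=m_1+\dots+m_n$, and let $k$ be a positive integer with $k<l(m)+1-k$. Let $1\le a\le n$ be such that $b:=k-\sum_{l=a}^n(m_l+1)>0$, and put $\tilde m=(m_1,\dots,m_{a-1},-m_a-2,\dots,-m_n-2)$. For $z=(z_1,\dots,z_n)\in\mathbb C^n$ with pairwise distinct coordinates let $$\Phi_{b,n}(t;z,\tilde m)=\prod_{i=1}^b\prod_{l=1}^n(t_i-z_l)^{-\tilde m_l}\prod_{1\le i<j\le b}(t_i-t_j)^2 .$$ A critical point of $\Phi_{b,n}(\cdot\,;z,\tilde m)$ is a point $t^0\in\mathbb C^b$ with pairwise distinct coordinates, all different from $z_1,\dots,z_n$, at which all partial derivatives $\partial\Phi_{b,n}/\partial t_i$ vanish. Let $$F(x)=\prod_{j=1}^n(x-z_j),\qquad G(x)=F(x)\sum_{j=1}^n\frac{-m_j}{x-z_j},\qquad U(x)=\prod_{i=1}^b(x-t^0_i)\prod_{l=a}^n(x-z_l)^{m_l+1}.$$ The equation $E(t^0,z,m,\tilde m)$ associated with $t^0$ is the equation $F(x)u''(x)+G(x)u'(x)+H(x)u(x)=0$,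 where $H$ is the unique polynomial of degree at most $n-2$ for which $U$ is a solution. For real $s>0$ let $z^{(s)}=(s,s^2,\dots,s^n)$. Then there is a number $S$, depending only on $n,m,k,a$, such that for every $s>S$ and every critical point $t^0$ of $\Phi_{b,n}(\cdot\,;z^{(s)},\tilde m)$ the associated equation $E(t^0,z^{(s)},m,\tilde m)$ is well defined (that is, $H$ exists and is unique) and its generic solution is multivalued: at every base point $x_0\in\mathbb C\setminus\{z^{(s)}_1,\dots,z^{(s)}_n\}$, every local holomorphic solution $u$ whose initial values $(u(x_0),u'(x_0))\in\mathbb C^2$ lie outside a suitable proper algebraic subset of $\mathbb C^2$ has an analytic continuation along some closed curve in $\mathbb C\setminus\{z^{(s)}_1,\dots,z^{(s)}_n\}$, starting and ending at $x_0$, that leads to a germ different from that of $u$. -/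

import Mathlib

open Polynomial Topology

noncomputable section

namespace SchVar

/-- The complement of the discriminantal arrangement: the points `t` of `ℂ^b` whose coordinates are
pairwise distinct and different from all the `z l`. -/
def complementSet {b n : ℕ} (z : Fin n → ℂ) : Set (Fin b → ℂ) :=
  {t | (∀ i l, t i ≠ z l) ∧ ∀ i j, i ≠ j → t i ≠ t j}

/-- The master function
`Φ(t; z, μ) = ∏ i, ∏ l, (t i - z l) ^ (-μ l) * ∏_{i < j} (t i - t j) ^ 2`
for integer exponents `μ`. -/
def masterFunction {b n : ℕ} (z : Fin n → ℂ) (μ : Fin n → ℤ) (t : Fin b → ℂ) : ℂ :=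
  (∏ i, ∏ l, (t i - z l) ^ (-μ l)) * ∏ i, ∏ j ∈ Finset.Ioi i, (t i - t j) ^ 2

/-- `t` is a critical point of the master function: it lies in the complement of the arrangement,
and all the partial derivatives vanish at `t`. -/
def IsCriticalPoint {b n : ℕ} (z : Fin n → ℂ) (μ : Fin n → ℤ) (t : Fin b → ℂ) : Prop :=
  t ∈ complementSet z ∧
    ∀ i, HasDerivAt (fun x : ℂ => masterFunction z μ (Function.update t i x)) 0 (t i)

/-- The exponents `m̃ = (m_1, …, m_{a-1}, -m_a - 2, …, -m_n - 2)`. -/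
def tildeExponents {n : ℕ} (m : Fin n → ℕ) (a : Fin n) : Fin n → ℤ :=
  fun l => if l < a then (m l : ℤ) else -(m l : ℤ) - 2

/-- The point `z^(s) = (s, s ^ 2, …, s ^ n)`. -/
def zPoint (n : ℕ) (s : ℝ) : Fin n → ℂ :=
  fun l => (s : ℂ) ^ ((l : ℕ) + 1)

/-- `F(x) = ∏ j, (x - z j)`. -/
def polyF {n : ℕ} (z : Fin n → ℂ) : ℂ[X] :=
  ∏ j, (X - C (z j))

/-- `G(x) = F(x) * ∑ j, -m j / (x - z j)`, as a polynomial. -/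
def polyG {n : ℕ} (z : Fin n → ℂ) (m : Fin n → ℕ) : ℂ[X] :=
  -∑ j, C (m j : ℂ) * ∏ i ∈ Finset.univ.erase j, (X - C (z i))

/-- `U(x) = ∏ i, (x - t i) * ∏_{l ≥ a} (x - z l) ^ (m l + 1)`. -/
def polyU {b n : ℕ} (z : Fin n → ℂ) (m : Fin n → ℕ) (a : Fin n) (t : Fin b → ℂ) : ℂ[X] :=
  (∏ i, (X - C (t i))) * ∏ l ∈ Finset.Ici a, (X - C (z l)) ^ (m l + 1)

/-- `F u'' + G u' + H u = 0` is the equation associated with `t`, `m` and `m̃`: `H` is a polynomial of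
degree at most `n - 2`, and the polynomial `U` is a solution. -/
def IsAssociated {b n : ℕ} (z : Fin n → ℂ) (m : Fin n → ℕ) (a : Fin n) (t : Fin b → ℂ)
    (H : ℂ[X]) : Prop :=
  H.degree < ((n - 1 : ℕ) : WithBot ℕ) ∧
    polyF z * derivative (derivative (polyU z m a t)) + polyG z m * derivative (polyU z m a t) +
      H * polyU z m a t = 0

/-- `u` is, near `x₀`, a holomorphic solution of `F u'' + G u' + H u = 0`. -/
def IsLocalSolution (F G H : ℂ[X]) (x₀ : ℂ) (u : ℂ → ℂ) : Prop :=
  AnalyticAt ℂ u x₀ ∧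
    ∀ᶠ x in 𝓝 x₀, F.eval x * deriv (deriv u) x + G.eval x * deriv u x + H.eval x * u x = 0

/-- `f` is an analytic continuation along the path `γ`: every `f τ` is holomorphic near `γ τ`, and the
germ of `f τ'` at `γ τ'` is the one given by `f τ` as soon as `τ'` is close to `τ`. -/
def IsContinuationAlong {x₀ x₁ : ℂ} (γ : Path x₀ x₁) (f : unitInterval → ℂ → ℂ) : Prop :=
  ∀ τ, AnalyticAt ℂ (f τ) (γ τ) ∧ ∀ᶠ τ' in 𝓝 τ, f τ' =ᶠ[𝓝 (γ τ')] f τ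

/-- The germ of `u` at `x₀` is multivalued on `D`: its analytic continuation along some closed curve
in `D` starting at `x₀` leads to a different germ. -/
def IsMultivalued (D : Set ℂ) (x₀ : ℂ) (u : ℂ → ℂ) : Prop :=
  ∃ (γ : Path x₀ x₀) (f : unitInterval → ℂ → ℂ), (∀ τ, γ τ ∈ D) ∧ IsContinuationAlong γ f ∧
    f 0 =ᶠ[𝓝 x₀] u ∧ ¬ f 1 =ᶠ[𝓝 x₀] u

/-- The generic solution of `F u'' + G u' + H u = 0` is multivalued (on the complement of the roots of
`F`). At a point `x₀` with `F x₀ ≠ 0` the solutions are parametrized by their initial values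
`(u x₀, u' x₀)` in `ℂ ^ 2`; generic means outside a proper algebraic subset of that plane. -/
def GenericSolutionMultivalued (F G H : ℂ[X]) : Prop :=
  ∀ x₀ : ℂ, F.eval x₀ ≠ 0 → ∃ P : MvPolynomial (Fin 2) ℂ, P ≠ 0 ∧
    ∀ u : ℂ → ℂ, IsLocalSolution F G H x₀ u → MvPolynomial.eval ![u x₀, deriv u x₀] P ≠ 0 →
      IsMultivalued {x | F.eval x ≠ 0} x₀ u

end SchVar

end

namespace SchVar

/-! ### Hermite reduction -/

/-! Put `P = ∏ (x - z_j)^{m_j}`. Since `P'/P = -G/F`, the Wronskian of two solutions is a multiple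
of `P`, so besides `U` the equation has the solution `U ∫ P/U²`. Hermite reduction gives `P/U² =
(V/U)' + ∑ r_c/(x - c)`, with a polynomial `V` and `c` running over the roots of `U`. The critical
point equations kill the residues at the `t_i` (`residue_eq_zero`), so the second solution is `V + U
∑_{j ≥ a} r_j log (x - z_j)` (`exists_polyP_eq`). If some `r_j ≠ 0`, a loop around `z_j` alone adds
a nonzero multiple of `U` to every solution not proportional to `U`
(`isMultivalued_of_residue_ne_zero`).

Otherwise `P` is the Wronskian of `U` and a polynomial `V`; this has to be excluded for large `s`.
From `deg U = k` and `2k < l(m) + 1` one gets `deg V ≤ K = l(m) + 1 - k`. If this happened for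
arbitrarily large `s`, divide all points by `z_n`: they tend to `0, …, 0, 1`, and by compactness
(`exists_wronskian_eq_of_tendsto`) the planes spanned by `U` and `V` accumulate at a plane with
Wronskian proportional to `x^l (x - 1)^q`, where `q = m_n` and `l = l(m) - q`. The limit of `U` has
degree at most `k` and keeps the divisor `(x - 1)^{q+1}`, so its order at `0` is `e ≤ k - q - 1`.
Another element of the plane has an order `d ≠ e` with `d ≤ K`. Hence `e + d ≤ l`, whereas a
Wronskian of order at least `l` at `0` needs `e + d ≥ l + 1` (`wronskian_ne_of_degree_le`). -/

lemma eval_prod_X_sub_C_eq_zero {ι : Type*} {s : Finset ι} (a : ι → ℂ) {i : ι} (hi : i ∈ s) :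
    (∏ j ∈ s, (X - C (a j))).eval (a i) = 0 := by
  rw [eval_prod]
  exact Finset.prod_eq_zero hi (by simp)

lemma eval_prod_erase_X_sub_C_ne_zero {ι : Type*} [DecidableEq ι] {a : ι → ℂ} (ha : Function.Injective a) (s : Finset ι)
    (i : ι) : (∏ j ∈ s.erase i, (X - C (a j))).eval (a i) ≠ 0 := by
  rw [eval_prod, Finset.prod_ne_zero_iff]
  intro j hj
  simpa [sub_eq_zero] using fun h => Finset.ne_of_mem_erase hj (ha h).symm

lemma prod_X_sub_C_dvd {ι : Type*} {a : ι → ℂ} (ha : Function.Injective a) {s : Finset ι} {p : ℂ[X]}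
    (h : ∀ i ∈ s, p.eval (a i) = 0) : ∏ i ∈ s, (X - C (a i)) ∣ p :=
  Finset.prod_dvd_of_coprime
    (fun _ _ _ _ hij => pairwise_coprime_X_sub_C ha hij)
    fun i hi => dvd_iff_isRoot.2 (h i hi)

lemma eval_sum_prod_erase {ι : Type*} [Fintype ι] [DecidableEq ι]
    (a : ι → ℂ) (c : ι → ℂ) (i : ι) :
    (∑ j, C (c j) * ∏ l ∈ Finset.univ.erase j, (X - C (a l))).eval (a i) =
      c i * (∏ l ∈ Finset.univ.erase i, (X - C (a l))).eval (a i) := by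
  rw [eval_finsetSum, Finset.sum_eq_single i]
  · simp
  · intro j _ hj
    rw [eval_mul, eval_prod_X_sub_C_eq_zero a (Finset.mem_erase.2 ⟨hj.symm, Finset.mem_univ i⟩),
      mul_zero]
  · simp

lemma exists_derivative_eq (p : ℂ[X]) : ∃ q : ℂ[X], derivative q = p := by
  induction p using Polynomial.induction_on' with
  | add p q hp hq =>
    obtain ⟨p', rfl⟩ := hp
    obtain ⟨q', rfl⟩ := hq
    exact ⟨p' + q', by simp⟩
  | monomial n c =>
    refine ⟨monomial (n + 1) (c / (n + 1)), ?_⟩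
    rw [derivative_monomial]
    have : (n : ℂ) + 1 ≠ 0 := Nat.cast_add_one_ne_zero n
    simp [this]

/-- Hermite reduction: a rational function whose denominator is
`∏ j, (x - a j) ^ (e j + 1)` is the derivative of a rational function with denominator
`∏ j, (x - a j) ^ e j` plus a sum of simple fractions. -/
theorem exists_hermite_reduction {ι : Type*} [Fintype ι] [DecidableEq ι]
    {a : ι → ℂ} (ha : Function.Injective a) (e : ι → ℕ) (N : ℂ[X]) :
    ∃ (V : ℂ[X]) (r : ι → ℂ),
      N = derivative V * ∏ j, (X - C (a j)) -
          V * ∑ j, C (e j : ℂ) * ∏ i ∈ Finset.univ.erase j, (X - C (a i)) +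
          (∏ j, (X - C (a j)) ^ e j) *
            ∑ j, C (r j) * ∏ i ∈ Finset.univ.erase j, (X - C (a i)) := by
  induction hs : ∑ j, e j generalizing e N with
  | zero =>
    have he : ∀ j, e j = 0 := by simpa using hs
    have hne := fun i => eval_prod_erase_X_sub_C_ne_zero ha Finset.univ i
    -- All poles are simple here: subtracting the residues leaves a polynomial, which has a
    -- primitive.
    set r : ι → ℂ := fun i =>
      N.eval (a i) / (∏ l ∈ Finset.univ.erase i, (X - C (a l))).eval (a i) with hr
    have hdvd : ∏ i, (X - C (a i)) ∣
        N - ∑ j, C (r j) * ∏ i ∈ Finset.univ.erase j, (X - C (a i)) := by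
      refine prod_X_sub_C_dvd ha fun i _ => ?_
      rw [eval_sub, eval_sum_prod_erase, hr, div_mul_cancel₀ _ (hne i), sub_self]
    obtain ⟨q, hq⟩ := hdvd
    obtain ⟨V, hV⟩ := exists_derivative_eq q
    refine ⟨V, r, ?_⟩
    simp only [he, Nat.cast_zero, map_zero, zero_mul, Finset.sum_const_zero, mul_zero, sub_zero,
      pow_zero, Finset.prod_const_one, one_mul, hV]
    linear_combination hq
  | succ d ih =>
    obtain ⟨i, hi⟩ : ∃ i, e i ≠ 0 := by
      by_contra! h
      simp [h] at hs
    obtain ⟨p, hp⟩ := Nat.exists_eq_succ_of_ne_zero hi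
    set e' := Function.update e i p with he'
    have hej : ∀ j, j ≠ i → e' j = e j := fun j hj => Function.update_of_ne hj _ _
    have hei : e' i = p := Function.update_self ..
    have hes : ∑ j, e' j = d := by
      have h1 : e i + ∑ j ∈ Finset.univ.erase i, e j = ∑ j, e j :=
        Finset.add_sum_erase Finset.univ e (Finset.mem_univ i)
      have h2 : e' i + ∑ j ∈ Finset.univ.erase i, e' j = ∑ j, e' j :=
        Finset.add_sum_erase Finset.univ e' (Finset.mem_univ i)
      have h3 : ∑ j ∈ Finset.univ.erase i, e' j = ∑ j ∈ Finset.univ.erase i, e j :=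
        Finset.sum_congr rfl fun j hj => hej j (Finset.ne_of_mem_erase hj)
      rw [hs, hp] at h1
      rw [hei] at h2
      omega
    set ρ : ι → ℂ[X] := fun j => ∏ l ∈ Finset.univ.erase j, (X - C (a l)) with hρ
    set K : ℂ[X] := ∑ j, C (e j : ℂ) * ρ j with hK
    set K' : ℂ[X] := ∑ j, C (e' j : ℂ) * ρ j with hK'
    have hKK : K = K' + ρ i := by
      rw [hK, hK', ← Finset.add_sum_erase _ _ (Finset.mem_univ i),
        ← Finset.add_sum_erase _ (fun j => C (e' j : ℂ) * ρ j) (Finset.mem_univ i),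
        Finset.sum_congr rfl fun j hj => by rw [← hej j (Finset.ne_of_mem_erase hj)], hei, hp]
      push_cast
      simp only [map_add, map_one]
      ring
    have hE : ∏ j, (X - C (a j)) ^ e j = (X - C (a i)) * ∏ j, (X - C (a j)) ^ e' j := by
      rw [← Finset.mul_prod_erase _ _ (Finset.mem_univ i),
        ← Finset.mul_prod_erase _ (fun j => (X - C (a j)) ^ e' j) (Finset.mem_univ i),
        Finset.prod_congr rfl fun j hj => by rw [← hej j (Finset.ne_of_mem_erase hj)], hei, hp, pow_succ]
      ring
    have hρi : (X - C (a i)) * ρ i = ∏ j, (X - C (a j)) :=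
      Finset.mul_prod_erase _ _ (Finset.mem_univ i)
    have hKi : K.eval (a i) ≠ 0 := by
      rw [hK, hρ, eval_sum_prod_erase]
      exact mul_ne_zero (Nat.cast_ne_zero.2 hi) (eval_prod_erase_X_sub_C_ne_zero ha _ _)
    -- Adding a multiple of `K`, that is, subtracting the derivative of a constant over the
    -- denominator, lowers the pole order at `a i`. The constant exists because `K` takes a nonzero
    -- value at `a i` when `e i ≠ 0`.
    have hdvd : X - C (a i) ∣ N + C (-N.eval (a i) / K.eval (a i)) * K := by
      rw [dvd_iff_isRoot, IsRoot.def, eval_add, eval_mul, eval_C, div_mul_cancel₀ _ hKi]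
      ring
    obtain ⟨N', hN'⟩ := hdvd
    obtain ⟨V, r, hV⟩ := ih e' N' hes
    refine ⟨C (-N.eval (a i) / K.eval (a i)) + (X - C (a i)) * V, r, ?_⟩
    rw [hE]
    simp only [derivative_add, derivative_mul, derivative_C, derivative_sub, derivative_X,
      zero_add, sub_zero, one_mul]
    change N = (V + (X - C (a i)) * derivative V) * _ - (_ + (X - C (a i)) * V) * K +
      _ * ∑ j, C (r j) * ρ j
    change N' = derivative V * _ - V * K' + _ * ∑ j, C (r j) * ρ j at hV
    linear_combination hN' + (X - C (a i)) * hV + (X - C (a i)) * V * hKK + V * hρi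

/-- Logarithmic derivative of a product, cleared of denominators. -/
lemma derivative_prod_X_sub_C_pow_mul {ι : Type*} [Fintype ι] [DecidableEq ι]
    (a : ι → ℂ) (e : ι → ℕ) :
    derivative (∏ j, (X - C (a j)) ^ e j) * ∏ j, (X - C (a j)) =
      (∏ j, (X - C (a j)) ^ e j) *
        ∑ j, C (e j : ℂ) * ∏ i ∈ Finset.univ.erase j, (X - C (a i)) := by
  rw [derivative_prod_finset, Finset.sum_mul, Finset.mul_sum]
  refine Finset.sum_congr rfl fun j _ => ?_
  rw [derivative_X_sub_C_pow]
  rw [← Finset.mul_prod_erase _ _ (Finset.mem_univ j),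
    ← Finset.mul_prod_erase _ (fun j => (X - C (a j)) ^ e j) (Finset.mem_univ j)]
  rcases Nat.eq_zero_or_pos (e j) with h | h
  · simp [h]
  · obtain ⟨p, hp⟩ := Nat.exists_eq_succ_of_ne_zero h.ne'
    rw [hp]
    simp only [Nat.succ_eq_add_one, Nat.add_sub_cancel]
    ring

/-- If `P / U ^ 2` has a pole of order at most `e j + 1` at each root `a j` of
`U = ∏ j, (x - a j) ^ e j`, then it is the derivative of some `V / U` plus simple fractions. -/
theorem exists_eq_wronskian_add {ι : Type*} [Fintype ι] [DecidableEq ι]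
    {a : ι → ℂ} (ha : Function.Injective a) {e : ι → ℕ}
    {N P : ℂ[X]} (Q : ι → ℂ[X])
    (hQ : ∀ j, Q j * (X - C (a j)) = ∏ j, (X - C (a j)) ^ e j)
    (hN : P * ∏ j, (X - C (a j)) = N * ∏ j, (X - C (a j)) ^ e j) :
    ∃ (V : ℂ[X]) (r : ι → ℂ),
      P = wronskian (∏ j, (X - C (a j)) ^ e j) V +
        (∏ j, (X - C (a j)) ^ e j) * ∑ j, C (r j) * Q j := by
  -- With `U = ∏ j, (x - a j) ^ e j`, the hypothesis `hN` says `P / U² = N / ∏ j, (x - a j) ^ (e j +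
  -- 1)`, and `(V / U)'` is the Wronskian divided by `U²`.
  obtain ⟨V, r, h⟩ := exists_hermite_reduction ha e N
  refine ⟨V, r, ?_⟩
  have hrad : ∏ j, (X - C (a j)) ≠ 0 := (monic_prod_X_sub_C _ _).ne_zero
  refine mul_right_cancel₀ hrad ?_
  have hK := derivative_prod_X_sub_C_pow_mul a e
  have hS : (∏ j, (X - C (a j)) ^ e j) * ∑ j, C (r j) * ∏ i ∈ Finset.univ.erase j, (X - C (a i)) =
      (∑ j, C (r j) * Q j) * ∏ j, (X - C (a j)) := by
    rw [Finset.mul_sum, Finset.sum_mul]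
    refine Finset.sum_congr rfl fun j _ => ?_
    rw [← hQ j, ← Finset.mul_prod_erase _ _ (Finset.mem_univ j)]
    ring
  rw [wronskian, hN]
  nth_rewrite 1 [h]
  linear_combination (∏ j, (X - C (a j)) ^ e j) * hS + V * hK

/-- The simple fraction at a simple root of `U` is absent from the decomposition of `P / U ^ 2`
if `U` solves `F u'' + G u' + H u = 0` and `P` is the Wronskian of the equation. -/
lemma residue_eq_zero {F G P U V R Q : ℂ[X]} {x r : ℂ}
    (hP : P = wronskian U V + U * (C r * Q + (X - C x) * R)) (hQ : Q * (X - C x) = U)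
    (hFP : F * derivative P = -(G * P)) (hFx : F.eval x ≠ 0) (hUx : (derivative U).eval x ≠ 0)
    (hU : (F * derivative (derivative U) + G * derivative U).eval x = 0) : r = 0 := by
  have hU0 : U.eval x = 0 := by rw [← hQ]; simp
  have hQx : (derivative U).eval x = Q.eval x := by rw [← hQ]; simp
  have h1 := congrArg (eval x) hP
  have h2 := congrArg (eval x) (congrArg derivative hP)
  have h3 := congrArg (eval x) hFP
  simp only [wronskian, derivative_add, derivative_sub, derivative_mul, derivative_C,
    derivative_X, eval_add, eval_sub, eval_mul, eval_C, eval_X, eval_neg, hU0,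
    sub_self, zero_mul, zero_add, add_zero, sub_zero, zero_sub] at h1 h2 h3 hU
  rw [← hQx] at h2
  -- At the root, `P = -U'V` and `P' = -U''V + r U'²`; inserted in `F P' = -G P` this gives `F U'² r
  -- = V (F U'' + G U') = 0`.
  have : F.eval x * (derivative U).eval x ^ 2 * r = 0 := by
    linear_combination (-F.eval x) * h2 - G.eval x * h1 + h3 + V.eval x * hU
  exact (mul_eq_zero.1 this).resolve_left (mul_ne_zero hFx (pow_ne_zero 2 hUx))

/-! ### Two-dimensional spaces of polynomials and degenerating Wronskians -/

/-- Two linearly independent polynomials with Wronskian `c x ^ l (x - 1) ^ q`, the first divisible by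
`(x - 1) ^ (q + 1)`: their degrees cannot add up to `l + q + 1` only. -/
theorem wronskian_ne_of_degree_le {l q k K : ℕ} {c : ℂ} {U V : ℂ[X]} (hU0 : U ≠ 0)
    (hind : ∀ c' : ℂ, V ≠ C c' * U) (hUk : U.natDegree ≤ k) (hVK : V.natDegree ≤ K) (hkK : k ≤ K)
    (hsum : k + K = l + q + 1) (hdvd : (X - 1) ^ (q + 1) ∣ U) :
    wronskian U V ≠ C c * (X ^ l * (X - 1) ^ q) := by
  intro hW
  -- factor out the powers of `x`
  have factor : ∀ p : ℂ[X], p ≠ 0 → ∃ (d : ℕ) (p' : ℂ[X]), p = X ^ d * p' ∧ p'.eval 0 ≠ 0 := by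
    intro p hp
    obtain ⟨p', h1, h2⟩ := exists_eq_pow_rootMultiplicity_mul_and_not_dvd p hp 0
    refine ⟨rootMultiplicity 0 p, p', by simpa using h1, ?_⟩
    rwa [dvd_iff_isRoot, IsRoot.def] at h2
  obtain ⟨e, U', rfl, hU'⟩ := factor U hU0
  -- a combination `W` of `U` and `V` with a different order at `0`
  obtain ⟨W, c', hWV, d, W', hWd, hW', hde⟩ : ∃ (W : ℂ[X]) (c' : ℂ), W = V - C c' * (X ^ e * U') ∧
      ∃ (d : ℕ) (W' : ℂ[X]), W = X ^ d * W' ∧ W'.eval 0 ≠ 0 ∧ d ≠ e := by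
    obtain ⟨d, V', hV, hV'⟩ := factor V (by simpa using hind 0)
    by_cases hde : d = e
    · subst hde
      -- Equal orders: cancelling the lowest coefficient strictly raises the order.
      set c' := V'.eval 0 / U'.eval 0 with hc'
      have hne : V' - C c' * U' ≠ 0 := by
        intro h
        exact hind c' (by rw [hV]; linear_combination X ^ d * h)
      obtain ⟨f, Y, hY, hY0⟩ := factor _ hne
      have hf : f ≠ 0 := by
        rintro rfl
        apply hY0
        rw [pow_zero, one_mul] at hY
        rw [← hY, eval_sub, eval_mul, eval_C, hc', div_mul_cancel₀ _ hU', sub_self]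
      refine ⟨_, c', rfl, d + f, Y, ?_, hY0, by omega⟩
      rw [hV, pow_add]
      linear_combination X ^ d * hY
    · exact ⟨V, 0, by simp, d, V', hV, hV', hde⟩
  have hWne : W ≠ 0 := by
    rintro rfl
    rcases mul_eq_zero.1 hWd.symm with h | h
    · exact X_ne_zero (eq_zero_of_pow_eq_zero h)
    · simp [h] at hW'
  have hdK : d ≤ K := by
    have h1 : W.natDegree ≤ K := by
      rw [hWV]
      refine (natDegree_sub_le _ _).trans (max_le hVK ?_)
      exact (natDegree_C_mul_le _ _).trans (hUk.trans hkK)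
    have h2 : (X ^ d : ℂ[X]).natDegree ≤ W.natDegree :=
      natDegree_le_of_dvd ⟨W', hWd⟩ hWne
    rw [natDegree_X_pow] at h2
    omega
  have hek : e + (q + 1) ≤ k := by
    have hcop : IsCoprime (X ^ e : ℂ[X]) ((X - 1) ^ (q + 1)) := by
      apply IsCoprime.pow
      exact ⟨1, -1, by ring⟩
    have h2 := natDegree_le_of_dvd (hcop.mul_dvd (dvd_mul_right _ _) hdvd) hU0
    have hm : ((X - 1 : ℂ[X]) ^ (q + 1)).natDegree = q + 1 := by
      rw [← C_1, natDegree_pow, natDegree_X_sub_C, mul_one]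
    have hm0 : (X - 1 : ℂ[X]) ^ (q + 1) ≠ 0 := by
      rw [← C_1]; exact pow_ne_zero _ (X_sub_C_ne_zero 1)
    rw [natDegree_mul (pow_ne_zero _ X_ne_zero) hm0, natDegree_X_pow, hm] at h2
    omega
  -- the order of the Wronskian at `0`
  have hWW : X * (C c * (X ^ l * (X - 1) ^ q)) =
      X ^ (e + d) * (C ((d : ℂ) - e) * U' * W' + X * wronskian U' W') := by
    have hpow : ∀ n : ℕ, X * derivative (X ^ n : ℂ[X]) = C (n : ℂ) * X ^ n := by
      rintro (_ | n)
      · simp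
      · rw [derivative_X_pow, Nat.add_sub_cancel]
        ring
    have : wronskian (X ^ e * U') V = wronskian (X ^ e * U') (X ^ d * W') := by
      rw [← hWd, hWV]
      simp only [wronskian, derivative_sub, derivative_C_mul]
      ring
    rw [← hW, this, wronskian, wronskian, derivative_mul, derivative_mul, pow_add, map_sub]
    linear_combination X ^ e * U' * W' * hpow d - X ^ d * U' * W' * hpow e
  have hL : X ^ (e + d) ∣ X ^ (l + 1) * (C c * (X - 1) ^ q) :=
    ⟨_, by rw [← hWW]; ring⟩
  set R : ℂ[X] := C ((d : ℂ) - e) * U' * W' + X * wronskian U' W' with hR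
  have hR0 : R.eval 0 ≠ 0 := by
    rw [hR]
    simp only [eval_add, eval_mul, eval_C, eval_X, zero_mul, add_zero]
    refine mul_ne_zero (mul_ne_zero ?_ hU') hW'
    rw [sub_ne_zero]
    exact_mod_cast hde
  -- Since `d ≠ e`, the lowest coefficient `(d - e) U'(0) W'(0)` survives. The resulting bound
  -- contradicts `hdK` and `hek`, which give `e + d ≤ l`.
  have hle : l + 1 ≤ e + d := by
    by_contra! hlt
    obtain ⟨j, hj⟩ := Nat.exists_eq_add_of_lt hlt
    have : R = X * (X ^ j * (C c * (X - 1) ^ q)) := by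
      refine mul_left_cancel₀ (pow_ne_zero (e + d) (X_ne_zero (R := ℂ))) ?_
      rw [← hWW]
      calc _ = X ^ (l + 1) * (C c * (X - 1) ^ q) := by ring
        _ = _ := by rw [hj]; ring
    rw [this] at hR0
    simp at hR0
  have hge : e + d ≤ l + 1 := by
    by_contra! hlt
    obtain ⟨j, hj⟩ := Nat.exists_eq_add_of_lt hlt
    have h : C c * (X - 1) ^ q = X * (X ^ j * R) := by
      refine mul_left_cancel₀ (pow_ne_zero (l + 1) (X_ne_zero (R := ℂ))) ?_
      calc _ = X * (C c * (X ^ l * (X - 1) ^ q)) := by ring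
        _ = _ := by rw [hWW, hj]; ring
    have hc : c = 0 := by
      have := congrArg (eval 0) h
      simpa using this
    rw [hc] at hWW
    simp only [map_zero, zero_mul, mul_zero] at hWW
    rcases mul_eq_zero.1 hWW.symm with h | h
    · exact X_ne_zero (eq_zero_of_pow_eq_zero h)
    · simp [h] at hR0
  omega

/-- The polynomials of degree at most `K`, given by their coefficients. -/
noncomputable def coeffPoly (K : ℕ) : EuclideanSpace ℂ (Fin (K + 1)) →ₗ[ℂ] ℂ[X] :=
  (degreeLT ℂ (K + 1)).subtype ∘ₗ (degreeLTEquiv ℂ (K + 1)).symm.toLinearMap ∘ₗ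
    (WithLp.linearEquiv 2 ℂ (Fin (K + 1) → ℂ)).toLinearMap

lemma coeffPoly_injective (K : ℕ) : Function.Injective (coeffPoly K) :=
  Subtype.val_injective.comp ((degreeLTEquiv ℂ (K + 1)).symm.injective.comp
    (WithLp.linearEquiv 2 ℂ (Fin (K + 1) → ℂ)).injective)

lemma natDegree_coeffPoly_le {K : ℕ} (v : EuclideanSpace ℂ (Fin (K + 1))) :
    (coeffPoly K v).natDegree ≤ K := by
  have h : coeffPoly K v ∈ degreeLT ℂ (K + 1) := Subtype.property _
  rw [mem_degreeLT] at h
  by_cases h0 : coeffPoly K v = 0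
  · simp [h0]
  · have := (natDegree_lt_iff_degree_lt h0).2 h
    omega

lemma exists_coeffPoly_eq {K : ℕ} {p : ℂ[X]} (hp : p.natDegree ≤ K) :
    ∃ v, coeffPoly K v = p := by
  have h : p ∈ degreeLT ℂ (K + 1) := by
    rw [mem_degreeLT]
    exact degree_le_natDegree.trans_lt (by exact_mod_cast Nat.lt_succ_of_le hp)
  refine ⟨(WithLp.linearEquiv 2 ℂ (Fin (K + 1) → ℂ)).symm (degreeLTEquiv ℂ (K + 1) ⟨p, h⟩), ?_⟩
  simp only [coeffPoly, LinearMap.comp_apply, LinearEquiv.coe_coe, LinearEquiv.apply_symm_apply,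
    LinearEquiv.symm_apply_apply, Submodule.subtype_apply]

lemma continuous_eval_coeffPoly (K : ℕ) (x : ℂ) : Continuous fun v => (coeffPoly K v).eval x :=
  ((leval x).comp (coeffPoly K)).continuous_of_finiteDimensional

lemma continuous_eval_derivative_coeffPoly (K : ℕ) (x : ℂ) :
    Continuous fun v => (derivative (coeffPoly K v)).eval x :=
  (((leval x).comp derivative).comp (coeffPoly K)).continuous_of_finiteDimensional

lemma wronskian_C_mul (a b : ℂ) (U V : ℂ[X]) :
    wronskian (C a * U) (C b * V) = C (a * b) * wronskian U V := by
  simp only [wronskian, derivative_C_mul, map_mul]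
  ring

/-- Planes of polynomials of bounded degree have limits: if polynomials with Wronskian proportional
to `∏ j, (x - w j) ^ m j` exist for a family of points `w` converging to `w₀`, then they exist
for `w₀`. -/
theorem exists_wronskian_eq_of_tendsto {n K : ℕ} (m : Fin n → ℕ) (T : Submodule ℂ ℂ[X])
    {α : Type*} {f : Filter α} {w : α → Fin n → ℂ} {w₀ : Fin n → ℂ}
    (hw : Filter.Tendsto w f (𝓝 w₀))
    (h : ∃ᶠ s in f, ∃ (U V : ℂ[X]) (c : ℂ), U ∈ T ∧ U.natDegree ≤ K ∧ V.natDegree ≤ K ∧ c ≠ 0 ∧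
      wronskian U V = C c * ∏ j, (X - C (w s j)) ^ m j) :
    ∃ (U V : ℂ[X]) (c : ℂ), U ∈ T ∧ U ≠ 0 ∧ (∀ c' : ℂ, V ≠ C c' * U) ∧ V.natDegree ≤ K ∧
      wronskian U V = C c * ∏ j, (X - C (w₀ j)) ^ m j := by
  let E := EuclideanSpace ℂ (Fin (K + 1))
  let W : E → E → ℂ → ℂ := fun u v x => (wronskian (coeffPoly K u) (coeffPoly K v)).eval x
  let D : (Fin n → ℂ) → ℂ → ℂ := fun w x => (∏ j, (X - C (w j)) ^ m j).eval x
  have hD : ∀ w x, D w x = ∏ j, (x - w j) ^ m j := fun w x => by simp [D, eval_prod]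
  have hWc : ∀ x, Continuous fun p : E × E × (Fin n → ℂ) => W p.1 p.2.1 x := by
    intro x
    simp only [W, wronskian, eval_sub, eval_mul]
    have h1 := continuous_eval_coeffPoly K x
    have h2 := continuous_eval_derivative_coeffPoly K x
    exact ((h1.comp continuous_fst).mul (h2.comp (continuous_fst.comp continuous_snd))).sub
      ((h2.comp continuous_fst).mul (h1.comp (continuous_fst.comp continuous_snd)))
  have hDc : ∀ x, Continuous fun p : E × E × (Fin n → ℂ) => D p.2.2 x := by
    intro x
    simp only [hD]
    fun_prop
  -- Orthonormal pairs form a compact set and cannot become dependent in the limit. Proportionality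
  -- of `W` and `D` is stated by cross multiplication, a closed condition that does not mention the
  -- factor.
  let Z : Set (E × E × (Fin n → ℂ)) :=
    (Metric.sphere 0 1 ×ˢ Metric.sphere 0 1 ×ˢ Metric.closedBall w₀ 1) ∩
      ({p | p.1 ∈ T.comap (coeffPoly K)} ∩ {p | inner ℂ p.1 p.2.1 = 0} ∩
        ⋂ x, ⋂ y, {p | W p.1 p.2.1 x * D p.2.2 y = W p.1 p.2.1 y * D p.2.2 x})
  have hZ : IsCompact Z := by
    refine IsCompact.inter_right ((isCompact_sphere _ _).prod ((isCompact_sphere _ _).prod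
      (isCompact_closedBall _ _))) ((IsClosed.inter ?_ ?_).inter ?_)
    · exact (Submodule.closed_of_finiteDimensional (T.comap (coeffPoly K))).preimage continuous_fst
    · exact isClosed_eq (by fun_prop) continuous_const
    · exact isClosed_iInter fun x => isClosed_iInter fun y =>
        isClosed_eq ((hWc x).mul (hDc y)) ((hWc y).mul (hDc x))
  have hmem : w₀ ∈ (fun p : E × E × (Fin n → ℂ) => p.2.2) '' Z := by
    refine (hZ.image (by fun_prop)).isClosed.mem_of_frequently_of_tendsto ?_ hw
    refine (h.and_eventually (hw.eventually (Metric.closedBall_mem_nhds w₀ one_pos))).mono ?_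
    rintro s ⟨⟨U, V, c, hUT, hU, hV, hc, hUV⟩, hs⟩
    obtain ⟨u, rfl⟩ := exists_coeffPoly_eq hU
    obtain ⟨v, rfl⟩ := exists_coeffPoly_eq hV
    have hne : wronskian (coeffPoly K u) (coeffPoly K v) ≠ 0 := by
      rw [hUV]
      exact mul_ne_zero (C_ne_zero.2 hc)
        (Finset.prod_ne_zero_iff.2 fun j _ => pow_ne_zero _ (X_sub_C_ne_zero _))
    have hu : u ≠ 0 := by
      rintro rfl
      simp at hne
    -- Gram–Schmidt changes only `v`, so the first vector stays in `T` and the Wronskian is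
    -- unchanged.
    set b : ℂ := inner ℂ u v / inner ℂ u u with hb
    set v' : E := v - b • u with hv'
    have hw' : wronskian (coeffPoly K u) (coeffPoly K v') =
        wronskian (coeffPoly K u) (coeffPoly K v) := by
      rw [hv', map_sub, map_smul, smul_eq_C_mul]
      simp only [wronskian, derivative_sub, derivative_C_mul]
      ring
    have hv0 : v' ≠ 0 := by
      intro h
      rw [h] at hw'
      simp only [map_zero, wronskian_zero_right] at hw'
      exact hne hw'.symm
    have hinner : inner ℂ u v' = 0 := by
      rw [hv', inner_sub_right, inner_smul_right, hb, div_mul_cancel₀ _ (inner_self_ne_zero.2 hu),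
        sub_self]
    refine ⟨(((‖u‖⁻¹ : ℝ) : ℂ) • u, ((‖v'‖⁻¹ : ℝ) : ℂ) • v', w s),
      ⟨⟨?_, ?_, hs⟩, ⟨?_, ?_⟩, ?_⟩, rfl⟩
    · simp [norm_smul, hu]
    · simp [norm_smul, inv_mul_cancel₀ (norm_ne_zero_iff.2 hv0)]
    · change coeffPoly K _ ∈ T
      rw [map_smul]
      exact T.smul_mem _ hUT
    · simp [hinner]
    · simp only [Set.mem_iInter, Set.mem_ofPred_eq]
      intro x y
      simp only [W, map_smul, smul_eq_C_mul, wronskian_C_mul, hw', hUV, eval_mul, eval_C, D]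
      ring
  obtain ⟨⟨u, v, w'⟩, ⟨⟨hu, hv, -⟩, ⟨hT, hinner⟩, hWD⟩, hw'⟩ := hmem
  change w' = w₀ at hw'
  subst hw'
  have hu0 : u ≠ 0 := by
    rintro rfl
    simp at hu
  -- The factor `c` is read off at any point `y` away from the limit points.
  obtain ⟨y, hy⟩ : ∃ y, D w' y ≠ 0 := by
    obtain ⟨y, hy⟩ := (Set.finite_range w').exists_notMem
    refine ⟨y, ?_⟩
    rw [hD, Finset.prod_ne_zero_iff]
    exact fun j _ => pow_ne_zero _ (sub_ne_zero.2 fun h => hy ⟨j, h.symm⟩)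
  refine ⟨coeffPoly K u, coeffPoly K v, W u v y / D w' y, hT, ?_, ?_, natDegree_coeffPoly_le v, ?_⟩
  · exact fun h => hu0 (coeffPoly_injective K (by rw [h, map_zero]))
  · intro c' h
    rw [← smul_eq_C_mul, ← map_smul] at h
    have h := coeffPoly_injective K h
    change inner ℂ u v = 0 at hinner
    rw [h, inner_smul_right, mul_eq_zero, inner_self_eq_zero, or_iff_left hu0] at hinner
    rw [hinner, zero_smul] at h
    subst h
    simp at hv
  · refine Polynomial.funext fun x => ?_
    have hxy := Set.mem_iInter.1 (Set.mem_iInter.1 hWD x) y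
    change W u v x * D w' y = W u v y * D w' x at hxy
    change W u v x = _
    rw [eval_mul, eval_C]
    change _ = W u v y / D w' y * D w' x
    field_simp
    exact hxy

/-! ### Degrees of Wronskians and rescaling of the points -/

/-- The coefficient of degree `deg U + deg V - 1` is `deg V - deg U` times the product of the
leading coefficients, so it does not cancel. This bounds `deg V` once the Wronskian is known. -/
lemma natDegree_add_le_natDegree_wronskian {U V : ℂ[X]} (hU : 0 < U.natDegree)
    (h : U.natDegree < V.natDegree) :
    U.natDegree + V.natDegree ≤ (wronskian U V).natDegree + 1 := by
  have hU0 : U ≠ 0 := by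
    rintro rfl
    simp at hU
  have hV0 : V ≠ 0 := by
    rintro rfl
    simp at h
  obtain ⟨p, hp⟩ := Nat.exists_eq_succ_of_ne_zero hU.ne'
  obtain ⟨q, hq⟩ := Nat.exists_eq_succ_of_ne_zero (hU.trans h).ne'
  have hcoeff : (wronskian U V).coeff (p + q + 1) =
      ((q : ℂ) - p) * (U.leadingCoeff * V.leadingCoeff) := by
    rw [wronskian, coeff_sub]
    have h1 : (U * derivative V).coeff (p + 1 + q) = _ :=
      coeff_mul_add_eq_of_natDegree_le hp.le
        ((natDegree_derivative_le V).trans (by rw [hq]; simp))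
    have h2 : (derivative U * V).coeff (p + (q + 1)) = _ :=
      coeff_mul_add_eq_of_natDegree_le
        ((natDegree_derivative_le U).trans (by rw [hp]; simp)) hq.le
    rw [show p + 1 + q = p + q + 1 by ring] at h1
    rw [← add_assoc] at h2
    rw [h1, h2, coeff_derivative, coeff_derivative, leadingCoeff, leadingCoeff, hp, hq]
    ring
  have : p + q + 1 ≤ (wronskian U V).natDegree := by
    refine le_natDegree_of_ne_zero ?_
    rw [hcoeff]
    refine mul_ne_zero (sub_ne_zero.2 ?_) (mul_ne_zero ?_ ?_)
    · norm_cast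
      omega
    · simpa using hU0
    · simpa using hV0
  omega

lemma natDegree_prod_X_sub_C_pow {n : ℕ} (z : Fin n → ℂ) (m : Fin n → ℕ) :
    (∏ j, (X - C (z j)) ^ m j).natDegree = ∑ j, m j := by
  rw [natDegree_prod _ _ fun j _ => pow_ne_zero _ (X_sub_C_ne_zero _)]
  simp

lemma wronskian_comp_C_mul_X (σ : ℂ) (U V : ℂ[X]) :
    wronskian (U.comp (C σ * X)) (V.comp (C σ * X)) = C σ * (wronskian U V).comp (C σ * X) := by
  simp only [wronskian, derivative_comp, derivative_C_mul, derivative_X, sub_comp, mul_comp,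
    mul_one]
  ring

lemma X_sub_C_comp_C_mul_X {σ : ℂ} (hσ : σ ≠ 0) (z : ℂ) :
    (X - C z).comp (C σ * X) = C σ * (X - C (z / σ)) := by
  rw [sub_comp, X_comp, C_comp, mul_sub, ← C_mul, mul_div_cancel₀ _ hσ]

/-- For large `s` there is no plane of polynomials with Wronskian `∏ j, (x - s ^ j) ^ m j` whose
element of least degree `k` vanishes at the last point `s ^ n`. -/
theorem exists_forall_wronskian_ne {n k : ℕ} (m : Fin (n + 1) → ℕ)
    (hk : 0 < k) (hkm : k + k < ∑ j, m j + 1) :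
    ∃ S : ℝ, ∀ s : ℝ, S < s → ∀ U V : ℂ[X], U.natDegree = k →
      (X - C (zPoint (n + 1) s (Fin.last n))) ^ (m (Fin.last n) + 1) ∣ U →
      wronskian U V ≠ ∏ j, (X - C (zPoint (n + 1) s j)) ^ m j := by
  by_contra! hcon
  set q := m (Fin.last n) with hq
  set K := ∑ j, m j + 1 - k with hK
  -- Dividing by the last point makes all other points collapse to `0`.
  let w : ℝ → Fin (n + 1) → ℂ := fun s j => zPoint (n + 1) s j / zPoint (n + 1) s (Fin.last n)
  let w₀ : Fin (n + 1) → ℂ := Fin.snoc (fun _ => 0) 1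
  have hw : Filter.Tendsto w Filter.atTop (𝓝 w₀) := by
    rw [tendsto_pi_nhds]
    intro j
    induction j using Fin.lastCases with
    | last =>
      simp only [w, w₀, Fin.snoc_last]
      refine tendsto_const_nhds.congr' ?_
      filter_upwards [Filter.eventually_gt_atTop (0 : ℝ)] with s hs
      rw [div_self]
      exact pow_ne_zero _ (Complex.ofReal_ne_zero.2 hs.ne')
    | cast j =>
      simp only [w, w₀, Fin.snoc_castSucc, zPoint, Fin.val_castSucc, Fin.val_last]
      have h1 : Filter.Tendsto (fun s : ℝ => ((s ^ (n - (j : ℕ)))⁻¹ : ℝ)) Filter.atTop (𝓝 0) :=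
        (Filter.tendsto_pow_atTop (by omega)).inv_tendsto_atTop
      have h2 := (Complex.continuous_ofReal.tendsto 0).comp h1
      rw [Complex.ofReal_zero] at h2
      refine h2.congr' ?_
      filter_upwards [Filter.eventually_gt_atTop (0 : ℝ)] with s hs
      have hs' : (s : ℂ) ≠ 0 := Complex.ofReal_ne_zero.2 hs.ne'
      simp only [Function.comp_apply, Complex.ofReal_inv, Complex.ofReal_pow]
      rw [eq_div_iff (pow_ne_zero _ hs'), inv_mul_eq_iff_eq_mul₀ (pow_ne_zero _ hs'), ← pow_add]
      congr 1
      omega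
  -- The properties of `U` that must survive the limit are linear conditions, hence closed ones in
  -- bounded degree.
  let T : Submodule ℂ ℂ[X] := degreeLT ℂ (k + 1) ⊓
    (Ideal.span {((X : ℂ[X]) - 1) ^ (q + 1)}).restrictScalars ℂ
  have hT : ∀ p, p ∈ T ↔ p.degree < ((k + 1 : ℕ) : WithBot ℕ) ∧ (X - 1) ^ (q + 1) ∣ p := by
    intro p
    simp only [T, Submodule.mem_inf, mem_degreeLT, Submodule.restrictScalars_mem,
      Ideal.mem_span_singleton]
  have hfreq : ∃ᶠ s in Filter.atTop, ∃ (U V : ℂ[X]) (c : ℂ), U ∈ T ∧ U.natDegree ≤ K ∧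
      V.natDegree ≤ K ∧ c ≠ 0 ∧ wronskian U V = C c * ∏ j, (X - C (w s j)) ^ m j := by
    rw [Filter.frequently_atTop]
    intro B
    obtain ⟨s, hs, U, V, hUk, hdvd, hUV⟩ := hcon (max B 0)
    have hs0 : 0 < s := (le_max_right _ _).trans_lt hs
    set σ : ℂ := zPoint (n + 1) s (Fin.last n) with hσ
    have hσ0 : σ ≠ 0 := pow_ne_zero _ (Complex.ofReal_ne_zero.2 hs0.ne')
    have hcomp : ∀ p : ℂ[X], (p.comp (C σ * X)).natDegree = p.natDegree := by
      intro p
      rw [natDegree_comp, natDegree_C_mul_X _ hσ0, mul_one]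
    -- If `deg V > K`, then `deg V > k` by `hkm`, and the Wronskian would have degree larger than `∑
    -- j, m j`.
    have hVK : V.natDegree ≤ K := by
      by_contra! h
      have h1 := natDegree_add_le_natDegree_wronskian (U := U) (V := V) (by omega) (by omega)
      rw [hUV, natDegree_prod_X_sub_C_pow] at h1
      omega
    refine ⟨s, (le_max_left _ _).trans hs.le, U.comp (C σ * X), V.comp (C σ * X),
      σ * ∏ j, σ ^ m j, (hT _).2 ⟨?_, ?_⟩, ?_, ?_, ?_, ?_⟩
    · refine degree_le_natDegree.trans_lt ?_
      rw [hcomp, hUk]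
      exact_mod_cast Nat.lt_succ_self k
    · obtain ⟨R, rfl⟩ := hdvd
      rw [mul_comp, pow_comp, X_sub_C_comp_C_mul_X hσ0, div_self hσ0, mul_pow, C_1]
      exact ⟨C σ ^ (q + 1) * R.comp (C σ * X), by ring⟩
    · rw [hcomp]
      omega
    · rwa [hcomp]
    · exact mul_ne_zero hσ0 (Finset.prod_ne_zero_iff.2 fun j _ => pow_ne_zero _ hσ0)
    · rw [wronskian_comp_C_mul_X, hUV, prod_comp]
      simp only [pow_comp, X_sub_C_comp_C_mul_X hσ0, mul_pow, Finset.prod_mul_distrib, map_mul,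
        map_prod, map_pow, w]
      ring
  obtain ⟨U, V, c, hUT, hU0, hind, hVK, hUV⟩ := exists_wronskian_eq_of_tendsto m T hw hfreq
  obtain ⟨hUk, hdvd⟩ := (hT U).1 hUT
  have hUk' : U.natDegree ≤ k := Nat.lt_succ_iff.1 ((natDegree_lt_iff_degree_lt hU0).2 hUk)
  refine wronskian_ne_of_degree_le (l := ∑ j : Fin n, m j.castSucc) (c := c) hU0 hind hUk' hVK
    (by omega) ?_ hdvd ?_
  · rw [Fin.sum_univ_castSucc] at hK hkm
    omega
  · rw [hUV, Fin.prod_univ_castSucc]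
    simp only [w₀, Fin.snoc_castSucc, Fin.snoc_last, map_zero, sub_zero, map_one,
      Finset.prod_pow_eq_pow_sum, ← hq]

/-! ### The equation associated with a critical point -/

lemma eval_derivative_prod_X_sub_C_pow {ι : Type*} [DecidableEq ι] (s : Finset ι) (a : ι → ℂ)
    (e : ι → ℕ) {x : ℂ} (hx : ∀ j ∈ s, x ≠ a j) :
    (derivative (∏ j ∈ s, (X - C (a j)) ^ e j)).eval x =
      (∏ j ∈ s, (X - C (a j)) ^ e j).eval x * ∑ j ∈ s, (e j : ℂ) / (x - a j) := by
  rw [derivative_prod_finset, eval_finsetSum, Finset.mul_sum]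
  refine Finset.sum_congr rfl fun j hj => ?_
  have hne : x - a j ≠ 0 := sub_ne_zero.2 (hx j hj)
  rw [← Finset.mul_prod_erase s _ hj, derivative_X_sub_C_pow]
  simp only [eval_mul, eval_pow, eval_sub, eval_X, eval_C]
  rcases Nat.eq_zero_or_pos (e j) with h | h
  · simp [h]
  · obtain ⟨p, hp⟩ := Nat.exists_eq_succ_of_ne_zero h.ne'
    rw [hp, Nat.succ_eq_add_one, Nat.add_sub_cancel, pow_succ]
    field_simp

/-- Only the `i`-th coordinate moves, and the squared difference of `t i` and `t j` contributes `2 /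
(t i - t j)` whichever index is larger. Vanishing of the sum is the Bethe form of the critical point
equation. -/
lemma logDeriv_masterFunction {b n : ℕ} {z : Fin n → ℂ} (μ : Fin n → ℤ) {t : Fin b → ℂ}
    (ht : t ∈ complementSet z) (i : Fin b) :
    logDeriv (fun x : ℂ => masterFunction z μ (Function.update t i x)) (t i) =
      ∑ l, (-μ l : ℂ) / (t i - z l) + ∑ j ∈ Finset.univ.erase i, 2 / (t i - t j) := by
  obtain ⟨htz, htt⟩ := ht
  set δ : Fin b → ℂ := Pi.single i 1 with hδ
  have hd : ∀ j, HasDerivAt (fun x => Function.update t i x j) (δ j) (t i) := fun j =>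
    hasDerivAt_pi.1 (hasDerivAt_update t i (t i)) j
  have hself : Function.update t i (t i) = t := Function.update_eq_self i t
  have h1 : ∀ j l, HasDerivAt (fun x => (Function.update t i x j - z l) ^ (-μ l))
      ((-μ l : ℤ) * (t j - z l) ^ (-μ l - 1) * δ j) (t i) := by
    intro j l
    have := (hasDerivAt_zpow (-μ l) (Function.update t i (t i) j - z l)
      (Or.inl (by rw [hself]; exact sub_ne_zero.2 (htz j l)))).comp (t i)
      ((hd j).sub_const (z l))
    rw [hself] at this
    exact this
  have h2 : ∀ j j', HasDerivAt (fun x => (Function.update t i x j - Function.update t i x j') ^ 2)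
      (2 * (t j - t j') * (δ j - δ j')) (t i) := by
    intro j j'
    have := ((hd j).fun_sub (hd j')).fun_pow 2
    rw [hself] at this
    refine this.congr_deriv ?_
    push_cast
    ring
  have hne1 : ∀ j l, (Function.update t i (t i) j - z l) ^ (-μ l) ≠ 0 := by
    intro j l
    rw [hself]
    exact zpow_ne_zero _ (sub_ne_zero.2 (htz j l))
  have hne2 : ∀ j, ∀ j' ∈ Finset.Ioi j,
      (Function.update t i (t i) j - Function.update t i (t i) j') ^ 2 ≠ 0 := by
    intro j j' hj
    rw [hself]
    exact pow_ne_zero _ (sub_ne_zero.2 (htt j j' (Finset.mem_Ioi.1 hj).ne))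
  unfold masterFunction
  rw [logDeriv_mul (t i) (Finset.prod_ne_zero_iff.2 fun j _ => Finset.prod_ne_zero_iff.2
      fun l _ => hne1 j l) (Finset.prod_ne_zero_iff.2 fun j _ => Finset.prod_ne_zero_iff.2 (hne2 j))
      (DifferentiableAt.fun_finsetProd fun j _ => DifferentiableAt.fun_finsetProd
        fun l _ => (h1 j l).differentiableAt)
      (DifferentiableAt.fun_finsetProd fun j _ => DifferentiableAt.fun_finsetProd
        fun j' _ => (h2 j j').differentiableAt)]
  congr 1
  · rw [logDeriv_prod (fun j _ => Finset.prod_ne_zero_iff.2 fun l _ => hne1 j l)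
      (fun j _ => DifferentiableAt.fun_finsetProd fun l _ => (h1 j l).differentiableAt),
      Finset.sum_eq_single i]
    · rw [logDeriv_prod (f := fun l x => (Function.update t i x i - z l) ^ (-μ l))
        (fun l _ => hne1 i l) (fun l _ => (h1 i l).differentiableAt)]
      refine Finset.sum_congr rfl fun l _ => ?_
      have hne : t i - z l ≠ 0 := sub_ne_zero.2 (htz i l)
      rw [logDeriv_apply, (h1 i l).deriv, hself, hδ, Pi.single_eq_same, zpow_sub_one₀ hne]
      have := zpow_ne_zero (-μ l) hne
      push_cast
      field_simp
    · intro j _ hj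
      rw [logDeriv_prod (f := fun l x => (Function.update t i x j - z l) ^ (-μ l))
        (fun l _ => hne1 j l) (fun l _ => (h1 j l).differentiableAt)]
      refine Finset.sum_eq_zero fun l _ => ?_
      rw [logDeriv_apply, (h1 j l).deriv, hδ, Pi.single_eq_of_ne hj, mul_zero, zero_div]
    · simp
  · rw [logDeriv_prod (fun j _ => Finset.prod_ne_zero_iff.2 (hne2 j))
      (fun j _ => DifferentiableAt.fun_finsetProd fun j' _ => (h2 j j').differentiableAt)]
    have hterm : ∀ j, logDeriv (fun x => ∏ j' ∈ Finset.Ioi j,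
        (Function.update t i x j - Function.update t i x j') ^ 2) (t i) =
        ∑ j' ∈ Finset.Ioi j, (2 / (t j - t j') * δ j + 2 / (t j' - t j) * δ j') := by
      intro j
      rw [logDeriv_prod (f := fun j' x => (Function.update t i x j - Function.update t i x j') ^ 2)
        (hne2 j) (fun j' _ => (h2 j j').differentiableAt)]
      refine Finset.sum_congr rfl fun j' hj' => ?_
      have hne : t j - t j' ≠ 0 := sub_ne_zero.2 (htt j j' (Finset.mem_Ioi.1 hj').ne)
      have hne' : t j' - t j ≠ 0 := sub_ne_zero.2 (htt j' j (Finset.mem_Ioi.1 hj').ne')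
      rw [logDeriv_apply, (h2 j j').deriv, hself, ← neg_sub (t j) (t j')]
      field_simp
      ring
    rw [Finset.sum_congr rfl fun j _ => hterm j]
    simp only [Finset.sum_add_distrib]
    -- `hA` collects the pairs with `i` as smaller index, `hB` those with `i` as larger index.
    have hA : ∑ j, ∑ j' ∈ Finset.Ioi j, 2 / (t j - t j') * δ j =
        ∑ j' ∈ Finset.Ioi i, 2 / (t i - t j') := by
      rw [Finset.sum_eq_single i]
      · simp [hδ]
      · intro j _ hj
        simp [hδ, Pi.single_eq_of_ne hj]
      · simp
    have hB : ∑ j, ∑ j' ∈ Finset.Ioi j, 2 / (t j' - t j) * δ j' =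
        ∑ j' ∈ Finset.Iio i, 2 / (t i - t j') := by
      rw [Finset.sum_comm' (t' := Finset.univ) (s' := fun j' => Finset.Iio j') (by simp),
        Finset.sum_eq_single i]
      · simp [hδ]
      · intro j _ hj
        simp [hδ, Pi.single_eq_of_ne hj]
      · simp
    rw [hA, hB, ← Finset.sum_union]
    · refine Finset.sum_congr ?_ fun _ _ => rfl
      ext j
      simp only [Finset.mem_union, Finset.mem_Ioi, Finset.mem_Iio, Finset.mem_erase,
        Finset.mem_univ, and_true]
      rw [or_comm, ← lt_or_lt_iff_ne]
    · rw [Finset.disjoint_left]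
      intro j hj hj'
      exact (Finset.mem_Ioi.1 hj).not_gt (Finset.mem_Iio.1 hj')

/-- The polynomial `∏ j, (x - z j) ^ m j`, the Wronskian of the equation. -/
noncomputable def polyP {n : ℕ} (z : Fin n → ℂ) (m : Fin n → ℕ) : ℂ[X] :=
  ∏ j, (X - C (z j)) ^ m j

/-- This is Abel's equation for Wronskians of solutions: `P' / P = -G / F`. -/
lemma polyF_mul_derivative_polyP {n : ℕ} (z : Fin n → ℂ) (m : Fin n → ℕ) :
    polyF z * derivative (polyP z m) = -(polyG z m * polyP z m) := by
  have h := derivative_prod_X_sub_C_pow_mul z m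
  rw [polyF, polyG, polyP]
  linear_combination h

section

variable {b n : ℕ} {z : Fin n → ℂ} {m : Fin n → ℕ} {a : Fin n} {t : Fin b → ℂ}

lemma eval_polyF_ne_zero {x : ℂ} : (polyF z).eval x ≠ 0 ↔ ∀ l, x ≠ z l := by
  simp [polyF, eval_prod, Finset.prod_eq_zero_iff, sub_eq_zero]

lemma eval_polyP_ne_zero {x : ℂ} (h : (polyF z).eval x ≠ 0) : (polyP z m).eval x ≠ 0 := by
  rw [polyP, eval_prod, Finset.prod_ne_zero_iff]
  intro l _
  simpa using fun h' => absurd (sub_eq_zero.1 h') (eval_polyF_ne_zero.1 h l)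

lemma polyU_ne_zero : polyU z m a t ≠ 0 :=
  mul_ne_zero (Finset.prod_ne_zero_iff.2 fun _ _ => X_sub_C_ne_zero _)
    (Finset.prod_ne_zero_iff.2 fun _ _ => pow_ne_zero _ (X_sub_C_ne_zero _))

lemma natDegree_polyU : (polyU z m a t).natDegree = b + ∑ l ∈ Finset.Ici a, (m l + 1) := by
  rw [polyU, natDegree_mul (Finset.prod_ne_zero_iff.2 fun _ _ => X_sub_C_ne_zero _)
    (Finset.prod_ne_zero_iff.2 fun _ _ => pow_ne_zero _ (X_sub_C_ne_zero _)),
    natDegree_prod _ _ fun _ _ => X_sub_C_ne_zero _,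
    natDegree_prod _ _ fun _ _ => pow_ne_zero _ (X_sub_C_ne_zero _)]
  simp

lemma eval_polyG {x : ℂ} (hx : ∀ l, x ≠ z l) :
    (polyG z m).eval x = -((polyF z).eval x * ∑ l, (m l : ℂ) / (x - z l)) := by
  have h := congrArg (eval x) (polyF_mul_derivative_polyP z m)
  rw [eval_mul, eval_neg, eval_mul, polyP,
    eval_derivative_prod_X_sub_C_pow _ _ _ fun l _ => hx l] at h
  have hP : (∏ j, (X - C (z j)) ^ m j).eval x ≠ 0 :=
    eval_polyP_ne_zero (eval_polyF_ne_zero.2 hx)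
  refine mul_right_cancel₀ hP ?_
  linear_combination h

/-- The polynomial `U` without its root `t i`. -/
noncomputable def polyUErase (z : Fin n → ℂ) (m : Fin n → ℕ) (a : Fin n) (t : Fin b → ℂ)
    (i : Fin b) : ℂ[X] :=
  (∏ j ∈ Finset.univ.erase i, (X - C (t j)) ^ 1) * ∏ l ∈ Finset.Ici a, (X - C (z l)) ^ (m l + 1)

lemma polyU_eq_mul_polyUErase (i : Fin b) :
    polyU z m a t = (X - C (t i)) * polyUErase z m a t i := by
  rw [polyU, polyUErase, ← Finset.mul_prod_erase _ _ (Finset.mem_univ i)]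
  simp only [pow_one]
  ring

lemma eval_polyUErase_ne_zero (ht : t ∈ complementSet z) (i : Fin b) :
    (polyUErase z m a t i).eval (t i) ≠ 0 := by
  rw [polyUErase, eval_mul, eval_prod, eval_prod]
  refine mul_ne_zero (Finset.prod_ne_zero_iff.2 fun j hj => ?_)
    (Finset.prod_ne_zero_iff.2 fun l _ => ?_)
  · simpa [sub_eq_zero] using ht.2 i j (Finset.ne_of_mem_erase hj).symm
  · simpa using fun h => absurd (sub_eq_zero.1 h) (ht.1 i l)

lemma eval_derivative_polyU (i : Fin b) :
    (derivative (polyU z m a t)).eval (t i) = (polyUErase z m a t i).eval (t i) := by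
  rw [polyU_eq_mul_polyUErase i]
  simp

/-- The critical point equation in terms of `U`. -/
lemma eval_root_eq_zero (ht : IsCriticalPoint z (tildeExponents m a) t) (i : Fin b) :
    (polyF z * derivative (derivative (polyU z m a t)) +
      polyG z m * derivative (polyU z m a t)).eval (t i) = 0 := by
  obtain ⟨htc, hd⟩ := ht
  have hlog := logDeriv_masterFunction (tildeExponents m a) htc i
  rw [logDeriv_apply, (hd i).deriv, zero_div] at hlog
  have h2 : (derivative (derivative (polyU z m a t))).eval (t i) =
      2 * (derivative (polyUErase z m a t i)).eval (t i) := by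
    rw [polyU_eq_mul_polyUErase i]
    simp only [derivative_mul, derivative_add, derivative_sub, derivative_X, derivative_C,
      eval_add, eval_sub, eval_mul, eval_X, eval_C]
    simp
    ring
  have h1 : (derivative (polyUErase z m a t i)).eval (t i) = (polyUErase z m a t i).eval (t i) *
      (∑ j ∈ Finset.univ.erase i, 1 / (t i - t j) +
        ∑ l ∈ Finset.Ici a, ((m l : ℂ) + 1) / (t i - z l)) := by
    rw [polyUErase, derivative_mul, eval_add, eval_mul, eval_mul,
      eval_derivative_prod_X_sub_C_pow _ t (fun _ => 1)
        fun j hj => htc.2 i j (Finset.ne_of_mem_erase hj).symm,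
      eval_derivative_prod_X_sub_C_pow _ z (fun l => m l + 1) fun l _ => htc.1 i l, eval_mul]
    push_cast
    ring
  -- For `l ≥ a` the exponent is `m l + 2 = 2 (m l + 1) - m l`: the first part comes from the factor
  -- `(x - z l) ^ (m l + 1)` of `U`, the second from `G / F`.
  have hsum : ∑ l, (-(tildeExponents m a l : ℂ)) / (t i - z l) =
      2 * ∑ l ∈ Finset.Ici a, ((m l : ℂ) + 1) / (t i - z l) - ∑ l, (m l : ℂ) / (t i - z l) := by
    have hIci : Finset.Ici a = Finset.univ.filter fun l => ¬ l < a := by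
      ext l
      simp
    rw [hIci, Finset.sum_filter, Finset.mul_sum, ← Finset.sum_sub_distrib]
    refine Finset.sum_congr rfl fun l _ => ?_
    by_cases h : l < a
    · simp [tildeExponents, h, neg_div]
    · simp only [tildeExponents, h, if_false, not_false_eq_true, if_true]
      push_cast
      ring
  have hsum2 : ∑ j ∈ Finset.univ.erase i, 2 / (t i - t j) =
      2 * ∑ j ∈ Finset.univ.erase i, 1 / (t i - t j) := by
    rw [Finset.mul_sum]
    exact Finset.sum_congr rfl fun j _ => by ring
  rw [hsum, hsum2] at hlog
  rw [eval_add, eval_mul, eval_mul, h2, h1, eval_polyG (htc.1 i), eval_derivative_polyU]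
  linear_combination (-(polyF z).eval (t i) * (polyUErase z m a t i).eval (t i)) * hlog

/-- The exponents of such an equation at `c` are `0` and `p + 1`: the terms of order `p` have
coefficients `(p + 1) p` and `-p (p + 1)` and cancel. -/
lemma pow_dvd_of_exponent {F₁ G₁ g : ℂ[X]} {c : ℂ} {p : ℕ} (hp : 0 < p) :
    (X - C c) ^ (p + 1) ∣
      (X - C c) * F₁ * derivative (derivative ((X - C c) ^ (p + 1) * g)) +
        (-(C (p : ℂ) * F₁) + (X - C c) * G₁) * derivative ((X - C c) ^ (p + 1) * g) := by
  obtain ⟨q, rfl⟩ := Nat.exists_eq_succ_of_ne_zero hp.ne'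
  refine ⟨F₁ * ((C (q : ℂ) + 3) * derivative g + (X - C c) * derivative (derivative g)) +
    G₁ * ((C (q : ℂ) + 2) * g + (X - C c) * derivative g), ?_⟩
  simp only [derivative_mul, derivative_X_sub_C_pow, derivative_C, derivative_one,
    Nat.succ_eq_add_one, Nat.add_sub_cancel, Nat.cast_add, Nat.cast_one, map_add, map_one]
  ring

/-- Every summand of `G` except the `l`-th vanishes at `z l`, which brings the equation into the
form of `pow_dvd_of_exponent`. -/
lemma pow_dvd_of_mem (hm : ∀ l, 0 < m l) {l : Fin n} (hl : l ∈ Finset.Ici a) :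
    (X - C (z l)) ^ (m l + 1) ∣ polyF z * derivative (derivative (polyU z m a t)) +
      polyG z m * derivative (polyU z m a t) := by
  have hF : polyF z = (X - C (z l)) * ∏ i ∈ Finset.univ.erase l, (X - C (z i)) :=
    (Finset.mul_prod_erase _ _ (Finset.mem_univ l)).symm
  have hU : polyU z m a t = (X - C (z l)) ^ (m l + 1) * ((∏ i, (X - C (t i))) *
      ∏ j ∈ (Finset.Ici a).erase l, (X - C (z j)) ^ (m j + 1)) := by
    rw [polyU, ← Finset.mul_prod_erase _ _ hl]
    ring
  obtain ⟨G₁, hG₁⟩ : (X - C (z l)) ∣ ∑ j ∈ Finset.univ.erase l,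
      C (m j : ℂ) * ∏ i ∈ Finset.univ.erase j, (X - C (z i)) := by
    refine Finset.dvd_sum fun j hj => Dvd.dvd.mul_left ?_ _
    exact Finset.dvd_prod_of_mem _ (Finset.mem_erase.2
      ⟨(Finset.ne_of_mem_erase hj).symm, Finset.mem_univ l⟩)
  have hG : polyG z m = -(C (m l : ℂ) * ∏ i ∈ Finset.univ.erase l, (X - C (z i))) +
      (X - C (z l)) * (-G₁) := by
    rw [polyG, ← Finset.add_sum_erase _ _ (Finset.mem_univ l), hG₁]
    ring
  rw [hF, hG, hU]
  exact pow_dvd_of_exponent (hm l)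

/-- The factors of `U` are coprime, so they are tested separately: the simple roots `t i` by the
critical point equations, the points `z l` by the local exponents. The quotient will be `-H`. -/
lemma polyU_dvd (hz : Function.Injective z) (hm : ∀ l, 0 < m l)
    (ht : IsCriticalPoint z (tildeExponents m a) t) :
    polyU z m a t ∣ polyF z * derivative (derivative (polyU z m a t)) +
      polyG z m * derivative (polyU z m a t) := by
  have htinj : Function.Injective t := fun i j h => by
    by_contra hne
    exact ht.1.2 i j hne h
  refine IsCoprime.mul_dvd ?_ (prod_X_sub_C_dvd htinj fun i _ => eval_root_eq_zero ht i)
    (Finset.prod_dvd_of_coprime (fun l _ l' _ hne => ?_) fun l hl => pow_dvd_of_mem hm hl)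
  · refine IsCoprime.prod_left fun i _ => IsCoprime.prod_right fun l _ => IsCoprime.pow_right ?_
    exact isCoprime_X_sub_C_of_isUnit_sub (sub_ne_zero.2 (ht.1.1 i l)).isUnit
  · exact IsCoprime.pow (pairwise_coprime_X_sub_C hz hne)

/-- The equation associated with a critical point is well defined. -/
theorem existsUnique_isAssociated (hz : Function.Injective z) (hm : ∀ l, 0 < m l) (hb : 0 < b)
    (ht : IsCriticalPoint z (tildeExponents m a) t) :
    ∃! H : ℂ[X], IsAssociated z m a t H := by
  obtain ⟨H, hH⟩ := polyU_dvd hz hm ht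
  have hU0 : polyU z m a t ≠ 0 := polyU_ne_zero
  refine ⟨-H, ⟨?_, by rw [hH]; ring⟩, ?_⟩
  · rcases eq_or_ne H 0 with rfl | hH0
    · simp
    rw [degree_neg, ← natDegree_lt_iff_degree_lt hH0]
    set U := polyU z m a t with hU
    have hn : 0 < n := a.pos
    have hk : 0 < U.natDegree := by
      rw [hU, natDegree_polyU]
      omega
    have hFd : (polyF z).natDegree ≤ n := by
      rw [polyF, natDegree_prod_of_monic _ _ fun _ _ => monic_X_sub_C _]
      simp
    have hGd : (polyG z m).natDegree ≤ n - 1 := by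
      rw [polyG, natDegree_neg]
      refine natDegree_sum_le_of_forall_le _ _ fun j _ => (natDegree_C_mul_le _ _).trans ?_
      rw [natDegree_prod_of_monic _ _ fun _ _ => monic_X_sub_C _]
      simp
    -- The truncated subtraction is exact, as `n` and `deg U` are positive. If `deg U < 2` the
    -- second derivative vanishes and needs its own case.
    have hsum : (polyF z * derivative (derivative U) + polyG z m * derivative U).natDegree ≤
        n + U.natDegree - 2 := by
      refine (natDegree_add_le _ _).trans (max_le ?_ ?_)
      · by_cases h2 : U.natDegree < 2
        · have : derivative (derivative U) = 0 := by
            have h1 : (derivative U).natDegree = 0 := by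
              have := natDegree_derivative_le U
              omega
            rw [eq_C_of_natDegree_eq_zero h1, derivative_C]
          simp [this]
        · refine natDegree_mul_le.trans ?_
          have h1 := natDegree_derivative_le U
          have h3 := natDegree_derivative_le (derivative U)
          omega
      · refine natDegree_mul_le.trans ?_
        have h1 := natDegree_derivative_le U
        omega
    rw [hH, natDegree_mul hU0 hH0] at hsum
    omega
  · rintro H' ⟨-, hH'⟩
    rw [hH] at hH'
    refine mul_right_cancel₀ hU0 ?_
    linear_combination hH'

/-- The second solution is `V + U * ∑ l ≥ a, r l * log (x - z l)`, with a polynomial `V`. -/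
theorem exists_polyP_eq (hz : Function.Injective z)
    (ht : IsCriticalPoint z (tildeExponents m a) t) :
    ∃ (V : ℂ[X]) (r : Fin n → ℂ), polyP z m = wronskian (polyU z m a t) V +
      polyU z m a t * ∑ l ∈ Finset.Ici a, C (r l) * (polyU z m a t /ₘ (X - C (z l))) := by
  let c : Fin b ⊕ Finset.Ici a → ℂ := Sum.elim t fun l => z l
  let e : Fin b ⊕ Finset.Ici a → ℕ := Sum.elim (fun _ => 1) fun l => m l + 1
  have hc : Function.Injective c := by
    refine Function.Injective.sumElim (fun i j h => ?_) (fun l l' h => Subtype.ext (hz h))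
      fun i l => ht.1.1 i l
    by_contra hne
    exact ht.1.2 i j hne h
  have hU : polyU z m a t = ∏ j, (X - C (c j)) ^ e j := by
    rw [polyU, Fintype.prod_sum_type, ← Finset.prod_coe_sort (Finset.Ici a)]
    simp [c, e]
  have hQ : ∀ j, polyU z m a t /ₘ (X - C (c j)) * (X - C (c j)) = ∏ j, (X - C (c j)) ^ e j := by
    intro j
    rw [mul_comm, ← hU, mul_divByMonic_eq_iff_isRoot, IsRoot.def, hU, eval_prod]
    refine Finset.prod_eq_zero (Finset.mem_univ j) ?_
    rcases j with j | j <;> simp [e]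
  -- The pole order of `P / U²` is `2 (m l + 1) - m l = (m l + 1) + 1` at `z l` with `l ≥ a`, and `2
  -- = 1 + 1` at `t i`, as Hermite reduction requires.
  have hN : polyP z m * ∏ j, (X - C (c j)) =
      (∏ l ∈ Finset.univ.filter (· < a), (X - C (z l)) ^ m l) * ∏ j, (X - C (c j)) ^ e j := by
    have hIci : Finset.Ici a = Finset.univ.filter fun l => ¬ l < a := by
      ext l
      simp
    have hsplit : polyP z m = (∏ l ∈ Finset.univ.filter (· < a), (X - C (z l)) ^ m l) *
        ∏ l ∈ Finset.Ici a, (X - C (z l)) ^ m l := by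
      rw [hIci, Finset.prod_filter_mul_prod_filter_not, polyP]
    have hrad : ∏ j, (X - C (c j)) = (∏ i, (X - C (t i))) * ∏ l ∈ Finset.Ici a, (X - C (z l)) := by
      rw [Fintype.prod_sum_type, ← Finset.prod_coe_sort (Finset.Ici a)]
      simp [c]
    rw [← hU, hsplit, hrad, polyU]
    simp only [pow_succ, Finset.prod_mul_distrib]
    ring
  obtain ⟨V, r, h⟩ := exists_eq_wronskian_add hc (fun j => polyU z m a t /ₘ (X - C (c j))) hQ hN
  rw [← hU] at h
  replace hQ : ∀ j, polyU z m a t /ₘ (X - C (c j)) * (X - C (c j)) = polyU z m a t :=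
    fun j => (hQ j).trans hU.symm
  have hct : ∀ i, c (Sum.inl i) = t i := fun _ => rfl
  have hcz : ∀ l, c (Sum.inr l) = z l := fun _ => rfl
  clear_value c
  have hr : ∀ i, r (Sum.inl i) = 0 := by
    intro i
    -- The summands of the other roots vanish at `t i`, so they form the term `(x - t i) R` of
    -- `residue_eq_zero`.
    have hdvd : ∀ j ∈ Finset.univ.erase (Sum.inl i : Fin b ⊕ Finset.Ici a),
        X - C (t i) ∣ C (r j) * (polyU z m a t /ₘ (X - C (c j))) := by
      intro j hj
      have hcop : IsCoprime (X - C (t i)) (X - C (c j)) := by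
        rw [← hct i]
        exact pairwise_coprime_X_sub_C hc (Finset.ne_of_mem_erase hj).symm
      have hU' : X - C (t i) ∣ (polyU z m a t /ₘ (X - C (c j))) * (X - C (c j)) := by
        rw [hQ, polyU_eq_mul_polyUErase i]
        exact dvd_mul_right _ _
      exact (hcop.dvd_of_dvd_mul_right hU').mul_left _
    obtain ⟨R, hR⟩ := Finset.dvd_sum hdvd
    have hQi := hQ (Sum.inl i)
    rw [← Finset.add_sum_erase _ _ (Finset.mem_univ (Sum.inl i : Fin b ⊕ Finset.Ici a)), hR] at h
    rw [hct] at h hQi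
    have hUi : (derivative (polyU z m a t)).eval (t i) ≠ 0 := by
      rw [eval_derivative_polyU]
      exact eval_polyUErase_ne_zero ht.1 i
    exact residue_eq_zero h hQi (polyF_mul_derivative_polyP z m)
      (eval_polyF_ne_zero.2 (ht.1.1 i)) hUi (eval_root_eq_zero ht i)
  refine ⟨V, fun l => if hl : l ∈ Finset.Ici a then r (Sum.inr ⟨l, hl⟩) else 0, ?_⟩
  nth_rewrite 1 [h]
  rw [Fintype.sum_sum_type, ← Finset.sum_coe_sort (Finset.Ici a)]
  simp [hr, hcz]

end

/-! ### Logarithms along paths -/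

/-- Some continuous branch of `log (x - z)` along `γ` changes by `d` from start to end. -/
def HasLogIncrement {x y : ℂ} (γ : Path x y) (z d : ℂ) : Prop :=
  ∃ (A B : ℂ) (L : Path A B), (∀ τ, Complex.exp (L τ) = γ τ - z) ∧ B - A = d

/-- At the junction the two branches have equal exponentials; shifting the second by the constant
difference glues them without changing its increment. -/
lemma HasLogIncrement.trans {x y w z d d' : ℂ} {γ : Path x y} {γ' : Path y w}
    (h : HasLogIncrement γ z d) (h' : HasLogIncrement γ' z d') :
    HasLogIncrement (γ.trans γ') z (d + d') := by
  obtain ⟨A, B, L, hL, rfl⟩ := h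
  obtain ⟨A', B', L', hL', rfl⟩ := h'
  have hB : Complex.exp (B - A') = 1 := by
    have h1 := hL 1
    have h2 := hL' 0
    rw [L.target, γ.target] at h1
    rw [L'.source, γ'.source, ← h1] at h2
    rw [Complex.exp_sub, h2, div_self (Complex.exp_ne_zero _)]
  let M : Path B (B' + (B - A')) :=
    (L'.map (f := fun c => c + (B - A')) (by fun_prop)).cast (by ring) rfl
  have hM : ∀ τ, Complex.exp (M τ) = γ' τ - z := by
    intro τ
    change Complex.exp (L' τ + (B - A')) = _
    rw [Complex.exp_add, hB, mul_one, hL']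
  refine ⟨A, _, L.trans M, fun τ => ?_, by ring⟩
  rw [Path.trans_apply, Path.trans_apply]
  split_ifs
  · exact hL _
  · exact hM _

lemma HasLogIncrement.symm {x y z d : ℂ} {γ : Path x y} (h : HasLogIncrement γ z d) :
    HasLogIncrement γ.symm z (-d) := by
  obtain ⟨A, B, L, hL, rfl⟩ := h
  exact ⟨B, A, L.symm, fun τ => hL _, by ring⟩

/-- Path lifting through the covering `exp : ℂ → ℂ \ {0}`. -/
lemma exists_hasLogIncrement {x y z : ℂ} (γ : Path x y) (h : ∀ τ, γ τ ≠ z) :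
    ∃ d, HasLogIncrement γ z d := by
  have hx : x - z ≠ 0 := by simpa [sub_eq_zero] using h 0
  let g : C(unitInterval, {w : ℂ // w ≠ 0}) :=
    ⟨fun τ => ⟨γ τ - z, sub_ne_zero.2 (h τ)⟩, by fun_prop⟩
  obtain ⟨Γ, hΓ, -⟩ := Complex.isCoveringMap_exp.exists_path_lifts g (Complex.log (x - z))
    (Subtype.ext (by simp [g, Complex.exp_log hx]))
  exact ⟨_, Γ 0, Γ 1, ⟨Γ, rfl, rfl⟩, fun τ => congrArg Subtype.val (congrFun hΓ τ), rfl⟩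

/-- The circle of radius `ρ` around `c`, run through once. -/
noncomputable def circleLoop (c : ℂ) (ρ : ℝ) : Path (c + ρ) (c + ρ) where
  toFun τ := c + ρ * Complex.exp (2 * Real.pi * Complex.I * (τ : ℝ))
  continuous_toFun := by fun_prop
  source' := by simp
  target' := by simp [Complex.exp_two_pi_mul_I]

lemma circleLoop_apply (c : ℂ) (ρ : ℝ) (τ : unitInterval) :
    circleLoop c ρ τ = c + ρ * Complex.exp (2 * Real.pi * Complex.I * (τ : ℝ)) := rfl

lemma norm_circleLoop_sub {c : ℂ} {ρ : ℝ} (hρ : 0 < ρ) (τ : unitInterval) :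
    ‖circleLoop c ρ τ - c‖ = ρ := by
  have : (2 * Real.pi * Complex.I * (τ : ℝ) : ℂ) = ((2 * Real.pi * τ : ℝ) : ℂ) * Complex.I := by
    push_cast
    ring
  rw [circleLoop_apply, add_sub_cancel_left, norm_mul, this, Complex.norm_exp_ofReal_mul_I,
    mul_one, Complex.norm_real, Real.norm_of_nonneg hρ.le]

lemma hasLogIncrement_circleLoop {c : ℂ} {ρ : ℝ} (hρ : 0 < ρ) :
    HasLogIncrement (circleLoop c ρ) c (2 * Real.pi * Complex.I) := by
  refine ⟨Real.log ρ, Real.log ρ + 2 * Real.pi * Complex.I,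
    ⟨⟨fun τ => Real.log ρ + 2 * Real.pi * Complex.I * (τ : ℝ), by fun_prop⟩, by simp, by simp⟩,
    fun τ => ?_, by ring⟩
  change Complex.exp (Real.log ρ + 2 * Real.pi * Complex.I * (τ : ℝ)) = _
  rw [circleLoop_apply, Complex.exp_add, ← Complex.ofReal_exp, Real.exp_log hρ]
  ring

/-- On the circle `(x - z) / (c - z)` stays at distance less than `1` from `1`, where the principal
logarithm is a single-valued continuous branch. -/
lemma hasLogIncrement_circleLoop_zero {c z : ℂ} {ρ : ℝ} (hρ : 0 < ρ) (hz : ρ < ‖c - z‖) :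
    HasLogIncrement (circleLoop c ρ) z 0 := by
  have hcz : c - z ≠ 0 := norm_pos_iff.1 (hρ.trans hz)
  have hslit : ∀ τ, 1 + (circleLoop c ρ τ - c) / (c - z) ∈ Complex.slitPlane := by
    intro τ
    apply Complex.mem_slitPlane_of_norm_lt_one
    rw [norm_div, norm_circleLoop_sub hρ, div_lt_one (hρ.trans hz)]
    exact hz
  have hcont : Continuous fun τ => Complex.log (c - z) +
      Complex.log (1 + (circleLoop c ρ τ - c) / (c - z)) :=
    continuous_const.add (Continuous.clog (by fun_prop) hslit)
  refine ⟨_, _, ⟨⟨_, hcont⟩, rfl, rfl⟩, fun τ => ?_, ?_⟩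
  · change Complex.exp (Complex.log (c - z) +
      Complex.log (1 + (circleLoop c ρ τ - c) / (c - z))) = _
    rw [Complex.exp_add, Complex.exp_log hcz, Complex.exp_log (Complex.slitPlane_ne_zero (hslit τ))]
    field_simp
    ring
  · simp

/-- A loop in the complement of the points `z l` with winding number `1` around one of them and `0`
around the others. -/
theorem exists_loop {n : ℕ} {z : Fin n → ℂ} (hz : Function.Injective z) {x₀ : ℂ}
    (hx₀ : ∀ l, x₀ ≠ z l) (l₀ : Fin n) :
    ∃ γ : Path x₀ x₀, (∀ τ l, γ τ ≠ z l) ∧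
      ∀ l, HasLogIncrement γ (z l) (if l = l₀ then 2 * Real.pi * Complex.I else 0) := by
  obtain ⟨ρ, hρ, hρl⟩ : ∃ ρ : ℝ, 0 < ρ ∧ ∀ l, l ≠ l₀ → ρ < ‖z l₀ - z l‖ := by
    have h : ∀ᶠ ρ : ℝ in 𝓝[>] 0, ∀ l, l ≠ l₀ → ρ < ‖z l₀ - z l‖ := by
      refine Filter.eventually_all.2 fun l => ?_
      by_cases hl : l = l₀
      · exact Filter.Eventually.of_forall fun _ h => absurd hl h
      · have hpos : 0 < ‖z l₀ - z l‖ := norm_pos_iff.2 (sub_ne_zero.2 fun h => hl (hz h).symm)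
        filter_upwards [Ioo_mem_nhdsGT hpos] with ρ hρ _
        exact hρ.2
    obtain ⟨ρ, h1, h2⟩ := (h.and self_mem_nhdsWithin).exists
    exact ⟨ρ, h2, h1⟩
  have hcirc : ∀ τ l, circleLoop (z l₀) ρ τ ≠ z l := by
    intro τ l h
    have h1 := norm_circleLoop_sub (c := z l₀) hρ τ
    rw [h] at h1
    by_cases hl : l = l₀
    · rw [hl, sub_self, norm_zero] at h1
      exact hρ.ne h1
    · rw [norm_sub_rev] at h1
      exact (hρl l hl).ne' h1
  have hconn : IsPathConnected (Set.range z)ᶜ :=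
    (Set.finite_range z).countable.isPathConnected_compl_of_one_lt_rank
      (by rw [Complex.rank_real_complex]; norm_num)
  obtain ⟨p, hp⟩ := hconn.joinedIn x₀ (by simpa [eq_comm] using hx₀) (z l₀ + ρ) (by
    rintro ⟨l, hl⟩
    exact hcirc 0 l (by rw [(circleLoop (z l₀) ρ).source, hl]))
  have hp' : ∀ τ l, p τ ≠ z l := fun τ l h => hp τ ⟨l, h.symm⟩
  refine ⟨(p.trans (circleLoop (z l₀) ρ)).trans p.symm, fun τ l => ?_, fun l => ?_⟩
  · rw [Path.trans_apply]
    split_ifs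
    · rw [Path.trans_apply]
      split_ifs
      · exact hp' _ _
      · exact hcirc _ _
    · exact hp' _ _
  · obtain ⟨d, hd⟩ := exists_hasLogIncrement p fun τ => hp' τ l
    -- The loop is the circle conjugated by `p`; the increments along `p` and back cancel.
    have key : ∀ d', HasLogIncrement (circleLoop (z l₀) ρ) (z l) d' →
        HasLogIncrement ((p.trans (circleLoop (z l₀) ρ)).trans p.symm) (z l) d' := by
      intro d' hd'
      have := (hd.trans hd').trans hd.symm
      rwa [show d + d' + -d = d' by ring] at this
    split_ifs with hl
    · subst hl
      exact key _ (hasLogIncrement_circleLoop hρ)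
    · exact key _ (hasLogIncrement_circleLoop_zero hρ (hρl l hl))

/-- The principal branch near `γ τ`, normalized by a continuous branch along `γ`, is locally
independent of `τ`. -/
lemma eventually_log_branch_eq {γ L : unitInterval → ℂ} {z : ℂ} (hL : Continuous L)
    (hexp : ∀ τ, Complex.exp (L τ) = γ τ - z) (τ : unitInterval) :
    ∀ᶠ τ' in 𝓝 τ, ∀ᶠ x in 𝓝 (γ τ'), L τ' + Complex.log ((x - z) / (γ τ' - z)) =
      L τ + Complex.log ((x - z) / (γ τ - z)) := by
  have hne : ∀ τ, γ τ - z ≠ 0 := fun τ => by rw [← hexp]; exact Complex.exp_ne_zero _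
  -- Two arguments below `π / 2` in absolute value add up without leaving the principal range, so
  -- `log` is additive on the product below.
  have him : ∀ᶠ τ' in 𝓝 τ, |(L τ' - L τ).im| < Real.pi / 2 := by
    have hc : Continuous fun τ' => |(L τ' - L τ).im| := by fun_prop
    exact hc.continuousAt.eventually_lt_const (by simp [Real.pi_pos])
  filter_upwards [him] with τ' him
  have hv : ∀ᶠ x in 𝓝 (γ τ'), 0 < ((x - z) / (γ τ' - z)).re := by
    have hc : Continuous fun x : ℂ => ((x - z) / (γ τ' - z)).re := by fun_prop
    exact hc.continuousAt.eventually_const_lt (by simp [div_self (hne τ')])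
  filter_upwards [hv] with x hx
  set v := (x - z) / (γ τ' - z) with hvdef
  set w := Complex.exp (L τ' - L τ) with hw
  have hlogw : Complex.log w = L τ' - L τ :=
    Complex.log_exp (by linarith [(abs_lt.1 him).1, Real.pi_pos])
      (by linarith [(abs_lt.1 him).2, Real.pi_pos])
  have hargw : |w.arg| < Real.pi / 2 := by rwa [← Complex.log_im, hlogw]
  have hargv : |v.arg| < Real.pi / 2 := Complex.abs_arg_lt_pi_div_two_iff.2 (Or.inl hx)
  have hv0 : v ≠ 0 := by
    intro h
    rw [h, Complex.zero_re] at hx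
    exact hx.false
  have hprod : (x - z) / (γ τ - z) = w * v := by
    rw [hw, Complex.exp_sub, hexp, hexp, hvdef]
    have := hne τ
    have := hne τ'
    field_simp
  rw [hprod, (Complex.log_mul_eq_add_log_iff (Complex.exp_ne_zero _) hv0).2, hlogw]
  · ring
  · have h1 := abs_lt.1 hargw
    have h2 := abs_lt.1 hargv
    constructor <;> linarith

/-! ### Solutions near a point and their continuation -/

/-- Holomorphic functions with vanishing Wronskian are proportional. -/
lemma exists_eq_const_mul {f g : ℂ → ℂ} {B : Set ℂ} (hB : IsOpen B) (hBc : IsPreconnected B)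
    (hf : AnalyticOnNhd ℂ f B) (hg : AnalyticOnNhd ℂ g B) {x₁ : ℂ} (hx₁ : x₁ ∈ B)
    (hfx : f x₁ ≠ 0) (h : ∀ x ∈ B, f x * deriv g x = deriv f x * g x) :
    ∃ c : ℂ, ∀ x ∈ B, g x = c * f x := by
  -- `f` may vanish elsewhere in `B`: the quotient is constant near `x₁` only, and the identity
  -- theorem does the rest.
  obtain ⟨ε, hε, hball⟩ := Metric.eventually_nhds_iff_ball.1
    ((hB.eventually_mem hx₁).and ((hf x₁ hx₁).continuousAt.eventually_ne hfx))
  obtain ⟨c, hc⟩ : ∃ c, ∀ x ∈ Metric.ball x₁ ε, g x / f x = c := by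
    have hd : ∀ x ∈ Metric.ball x₁ ε, HasDerivAt (fun x => g x / f x) 0 x := by
      intro x hx
      have h1 := (hg x (hball x hx).1).differentiableAt.hasDerivAt.fun_div
        (hf x (hball x hx).1).differentiableAt.hasDerivAt (hball x hx).2
      refine h1.congr_deriv ?_
      rw [div_eq_zero_iff]
      left
      linear_combination h x (hball x hx).1
    exact Metric.isOpen_ball.exists_is_const_of_deriv_eq_zero
      (convex_ball x₁ ε).isPreconnected
      (fun x hx => (hd x hx).differentiableAt.differentiableWithinAt) fun x hx => (hd x hx).deriv
  refine ⟨c, hg.eqOn_of_preconnected_of_eventuallyEq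
    (fun x hx => analyticAt_const.mul (hf x hx)) hBc hx₁ ?_⟩
  filter_upwards [Metric.ball_mem_nhds x₁ hε] with x hx
  rw [← hc x hx, div_mul_cancel₀ _ (hball x hx).2]

lemma analyticAt_eval (p : ℂ[X]) (x : ℂ) : AnalyticAt ℂ (fun x => p.eval x) x :=
  (AnalyticOnNhd.eval_polynomial p) x (Set.mem_univ x)

lemma frequently_eval_ne_zero {p : ℂ[X]} (hp : p ≠ 0) (x₀ : ℂ) : ∃ᶠ x in 𝓝 x₀, p.eval x ≠ 0 := by
  intro h
  simp only [not_not] at h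
  have hev : (fun x => p.eval x) =ᶠ[𝓝 x₀] fun _ => 0 := h
  have hp' : AnalyticOnNhd ℂ (fun x => p.eval x) Set.univ := fun x _ => analyticAt_eval p x
  have := hp'.eqOn_of_preconnected_of_eventuallyEq analyticOnNhd_const isPreconnected_univ
    (Set.mem_univ x₀) hev
  exact hp (Polynomial.funext fun x => by simpa using this (Set.mem_univ x))

/-- Every local solution is a combination of the polynomial solution `U` and of a second solution
with the Wronskian `P`. -/
lemma exists_eq_combination {F G H P U : ℂ[X]} {x₀ : ℂ} {u v : ℂ → ℂ} (hU0 : U ≠ 0)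
    (hU : F * derivative (derivative U) + G * derivative U + H * U = 0)
    (hFP : F * derivative P = -(G * P)) (hF : F.eval x₀ ≠ 0) (hP : P.eval x₀ ≠ 0)
    (hu : IsLocalSolution F G H x₀ u) (hv : AnalyticAt ℂ v x₀)
    (hUv : ∀ᶠ x in 𝓝 x₀, U.eval x * deriv v x - (derivative U).eval x * v x = P.eval x) :
    ∃ c₀ c : ℂ, ∀ᶠ x in 𝓝 x₀, u x = c₀ * U.eval x + c * v x := by
  obtain ⟨ε, hε, hball⟩ := Metric.eventually_nhds_iff_ball.1
    (hu.1.eventually_analyticAt.and (hu.2.and (hv.eventually_analyticAt.and (hUv.and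
      (F.continuous.continuousAt.eventually_ne hF)))))
  set B := Metric.ball x₀ ε with hB
  have hBo : IsOpen B := Metric.isOpen_ball
  have hBc : IsPreconnected B := (convex_ball x₀ ε).isPreconnected
  have hx₀ : x₀ ∈ B := Metric.mem_ball_self hε
  have hdU : ∀ x, HasDerivAt (fun x => U.eval x) ((derivative U).eval x) x := U.hasDerivAt
  have hddU : ∀ x, HasDerivAt (fun x => (derivative U).eval x)
    ((derivative (derivative U)).eval x) x := (derivative U).hasDerivAt
  have hUx : ∀ x, F.eval x * (derivative (derivative U)).eval x +
      G.eval x * (derivative U).eval x + H.eval x * U.eval x = 0 := fun x => by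
    simpa using congrArg (eval x) hU
  have hFPx : ∀ x, F.eval x * (derivative P).eval x = -(G.eval x * P.eval x) := fun x => by
    simpa using congrArg (eval x) hFP
  -- the Wronskian of `U` and `u` is a multiple of `P`
  obtain ⟨c, hc⟩ := exists_eq_const_mul (f := fun x => P.eval x)
    (g := fun x => U.eval x * deriv u x - (derivative U).eval x * u x) hBo hBc
    (fun x _ => analyticAt_eval P x)
    (fun x hx => ((analyticAt_eval U x).mul (hball x hx).1.deriv).sub
      ((analyticAt_eval _ x).mul (hball x hx).1)) hx₀ hP (by
    intro x hx
    obtain ⟨hux, hode, -, -, hFx⟩ := hball x hx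
    have hd := ((hdU x).fun_mul hux.deriv.differentiableAt.hasDerivAt).fun_sub
      ((hddU x).fun_mul hux.differentiableAt.hasDerivAt)
    rw [hd.deriv, P.deriv]
    refine mul_left_cancel₀ hFx ?_
    linear_combination (P.eval x * U.eval x) * hode - (P.eval x * u x) * hUx x -
      (U.eval x * deriv u x - (derivative U).eval x * u x) * hFPx x)
  -- `U` may vanish at `x₀`, so a nearby point is used. The Wronskian of `U` and `u - c v` is zero,
  -- whence `u - c v` is a multiple of `U`.
  obtain ⟨x₁, hx₁, hUx₁⟩ : ∃ x₁ ∈ B, U.eval x₁ ≠ 0 := by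
    obtain ⟨x₁, h1, h2⟩ := ((frequently_eval_ne_zero hU0 x₀).and_eventually
      (hBo.eventually_mem hx₀)).exists
    exact ⟨x₁, h2, h1⟩
  obtain ⟨c₀, hc₀⟩ := exists_eq_const_mul (f := fun x => U.eval x) (g := fun x => u x - c * v x)
    hBo hBc (fun x _ => analyticAt_eval U x)
    (fun x hx => (hball x hx).1.sub (analyticAt_const.mul (hball x hx).2.2.1)) hx₁ hUx₁ (by
    intro x hx
    obtain ⟨hux, -, hvx, hUvx, -⟩ := hball x hx
    have hd := hux.differentiableAt.hasDerivAt.fun_sub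
      (hvx.differentiableAt.hasDerivAt.const_mul c)
    rw [hd.deriv, U.deriv]
    linear_combination hc x hx - c * hUvx)
  refine ⟨c₀, c, ?_⟩
  filter_upwards [hBo.mem_nhds hx₀] with x hx
  linear_combination hc₀ x hx

lemma hasDerivAt_log_div {x c w : ℂ} (hw : w - c ≠ 0) (hx : (x - c) / (w - c) ∈ Complex.slitPlane) :
    HasDerivAt (fun x => Complex.log ((x - c) / (w - c))) (1 / (x - c)) x := by
  have h := (((hasDerivAt_id x).sub_const c).div_const (w - c)).clog hx
  refine h.congr_deriv ?_
  have : x - c ≠ 0 := by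
    intro h0
    apply Complex.slitPlane_ne_zero hx
    rw [h0, zero_div]
  simp only [id]
  field_simp

lemma eventually_mem_slitPlane {c w : ℂ} (hw : w - c ≠ 0) :
    ∀ᶠ x in 𝓝 w, (x - c) / (w - c) ∈ Complex.slitPlane := by
  have hc : Continuous fun x : ℂ => (x - c) / (w - c) := by fun_prop
  refine hc.continuousAt.eventually_mem (Complex.isOpen_slitPlane.mem_nhds ?_)
  rw [div_self hw]
  exact Complex.one_mem_slitPlane

lemma analyticAt_log_div {c w : ℂ} (hw : w - c ≠ 0) :
    AnalyticAt ℂ (fun x => Complex.log ((x - c) / (w - c))) w :=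
  ((analyticAt_id.sub analyticAt_const).div_const).clog (eventually_mem_slitPlane hw).self_of_nhds

/-- The generic solution is multivalued as soon as the second solution involves a logarithm. -/
theorem isMultivalued_of_residue_ne_zero {n : ℕ} {z : Fin n → ℂ} {s : Finset (Fin n)}
    {r : Fin n → ℂ} {F G H P U V : ℂ[X]} (hz : Function.Injective z)
    (hU0 : U ≠ 0) (hU : F * derivative (derivative U) + G * derivative U + H * U = 0)
    (hFP : F * derivative P = -(G * P)) (hF : ∀ x, F.eval x ≠ 0 ↔ ∀ l, x ≠ z l)
    (hP : ∀ x, F.eval x ≠ 0 → P.eval x ≠ 0) (Q : Fin n → ℂ[X])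
    (hQ : ∀ l ∈ s, Q l * (X - C (z l)) = U)
    (hPV : P = wronskian U V + U * ∑ l ∈ s, C (r l) * Q l) {l₀ : Fin n} (hl₀ : l₀ ∈ s)
    (hr : r l₀ ≠ 0) {x₀ : ℂ} (hx₀ : F.eval x₀ ≠ 0) {u : ℂ → ℂ} (hu : IsLocalSolution F G H x₀ u)
    (hW : U.eval x₀ * deriv u x₀ - (derivative U).eval x₀ * u x₀ ≠ 0) :
    IsMultivalued {x | F.eval x ≠ 0} x₀ u := by
  have hne : ∀ w, (∀ l, w ≠ z l) → ∀ l, w - z l ≠ 0 := fun w hw l => sub_ne_zero.2 (hw l)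
  have hx₀z := (hF x₀).1 hx₀
  -- the second solution
  set v : ℂ → ℂ := fun x => V.eval x +
    U.eval x * ∑ l ∈ s, r l * Complex.log ((x - z l) / (x₀ - z l)) with hv
  have hvan : AnalyticAt ℂ v x₀ := (analyticAt_eval V x₀).add ((analyticAt_eval U x₀).mul
    (Finset.analyticAt_fun_sum _ fun l _ =>
      analyticAt_const.mul (analyticAt_log_div (hne x₀ hx₀z l))))
  have hUv : ∀ᶠ x in 𝓝 x₀, U.eval x * deriv v x - (derivative U).eval x * v x = P.eval x := by
    filter_upwards [Filter.eventually_all.2 fun l => eventually_mem_slitPlane (hne x₀ hx₀z l),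
      F.continuous.continuousAt.eventually_ne hx₀] with x hx hFx
    have hxz := hne x ((hF x).1 hFx)
    have hd : HasDerivAt v _ x := (V.hasDerivAt x).fun_add ((U.hasDerivAt x).fun_mul
      (HasDerivAt.fun_sum fun l _ => (hasDerivAt_log_div (hne x₀ hx₀z l) (hx l)).const_mul (r l)))
    have hsum : U.eval x * ∑ l ∈ s, r l * (1 / (x - z l)) = ∑ l ∈ s, r l * (Q l).eval x := by
      rw [Finset.mul_sum]
      refine Finset.sum_congr rfl fun l hl => ?_
      have h1 := congrArg (eval x) (hQ l hl)
      rw [eval_mul, eval_sub, eval_X, eval_C] at h1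
      have := hxz l
      rw [← h1]
      field_simp
    rw [hd.deriv, hsum, hPV, hv]
    simp only [wronskian, eval_add, eval_sub, eval_mul, eval_finsetSum, eval_C]
    ring
  obtain ⟨c₀, c, hcomb⟩ := exists_eq_combination hU0 hU hFP hx₀ (hP x₀ hx₀) hu hvan hUv
  have hc : c ≠ 0 := by
    rintro rfl
    apply hW
    have h1 : u =ᶠ[𝓝 x₀] fun x => c₀ * U.eval x := by
      filter_upwards [hcomb] with x hx
      rw [hx, zero_mul, add_zero]
    rw [h1.deriv_eq, h1.self_of_nhds, ((U.hasDerivAt x₀).const_mul c₀).deriv]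
    ring
  -- the continuation along a loop around `z l₀`
  obtain ⟨γ, hγ, hlog⟩ := exists_loop hz hx₀z l₀
  choose A B L hL hAB using hlog
  -- Each logarithm of `v` is replaced by its continued branch; subtracting `A l` makes `f 0` agree
  -- with `u`.
  set f : unitInterval → ℂ → ℂ := fun τ x => c₀ * U.eval x + c * (V.eval x + U.eval x *
    ∑ l ∈ s, r l * (L l τ + Complex.log ((x - z l) / (γ τ - z l)) - A l)) with hf
  refine ⟨γ, f, fun τ => (hF _).2 (hγ τ), fun τ => ⟨?_, ?_⟩, ?_, ?_⟩
  · exact (analyticAt_const.mul (analyticAt_eval U _)).add (analyticAt_const.mul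
      ((analyticAt_eval V _).add ((analyticAt_eval U _).mul (Finset.analyticAt_fun_sum _ fun l _ =>
        analyticAt_const.mul ((analyticAt_const.add
          (analyticAt_log_div (hne _ (hγ τ) l))).sub analyticAt_const)))))
  · filter_upwards [Filter.eventually_all.2 fun l =>
      eventually_log_branch_eq (L l).continuous (hL l) τ] with τ' hτ'
    filter_upwards [Filter.eventually_all.2 hτ'] with x hx
    simp only [hf, hx]
  · filter_upwards [hcomb] with x hx
    rw [hx]
    simp only [hf, hv, γ.source, (L _).source, add_sub_cancel_left]
  · intro h
    refine frequently_eval_ne_zero hU0 x₀ ?_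
    filter_upwards [hcomb, h] with x hx hx'
    rw [hx] at hx'
    have hB : ∀ l, B l = A l + if l = l₀ then 2 * Real.pi * Complex.I else 0 := fun l => by
      rw [← hAB l]
      ring
    simp only [hf, hv, γ.target, (L _).target, hB] at hx'
    -- The left side is the difference of the final and the initial germ; its vanishing would force
    -- `U` to vanish near `x₀`.
    have h2 : c * U.eval x * (r l₀ * (2 * Real.pi * Complex.I)) = 0 := by
      have h3 : ∑ l ∈ s, r l * ((A l + if l = l₀ then 2 * Real.pi * Complex.I else 0) +
          Complex.log ((x - z l) / (x₀ - z l)) - A l) =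
          ∑ l ∈ s, r l * Complex.log ((x - z l) / (x₀ - z l)) +
            r l₀ * (2 * Real.pi * Complex.I) := by
        have h4 : ∑ l ∈ s, r l * (if l = l₀ then 2 * Real.pi * Complex.I else 0) =
            r l₀ * (2 * Real.pi * Complex.I) := by
          simp [hl₀]
        rw [← h4, ← Finset.sum_add_distrib]
        exact Finset.sum_congr rfl fun l _ => by ring
      rw [h3] at hx'
      linear_combination hx'
    have h5 : r l₀ * (2 * Real.pi * Complex.I) ≠ 0 :=
      mul_ne_zero hr Complex.two_pi_I_ne_zero
    rw [not_not]
    exact ((mul_eq_zero.1 h2).resolve_right h5 |> mul_eq_zero.1).resolve_left hc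

/-! ### From a nonzero residue to generic multivaluedness -/

lemma zPoint_injective (n : ℕ) {s : ℝ} (hs : 1 < s) : Function.Injective (zPoint n s) := by
  intro i j h
  have h1 : s ^ ((i : ℕ) + 1) = s ^ ((j : ℕ) + 1) := by
    simp only [zPoint] at h
    exact_mod_cast h
  have h2 := pow_right_injective₀ (by linarith) hs.ne' h1
  exact Fin.ext (by simpa using h2)

/-- A solution `U` of `F u'' + G u' + H u = 0` has no multiple root off the singular points. -/
lemma eval_polyU_ne_zero_or {b n : ℕ} {z : Fin n → ℂ} {m : Fin n → ℕ} {a : Fin n} {t : Fin b → ℂ}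
    (ht : t ∈ complementSet z) {x : ℂ} (hx : ∀ l, x ≠ z l) :
    (polyU z m a t).eval x ≠ 0 ∨ (derivative (polyU z m a t)).eval x ≠ 0 := by
  by_cases h : ∃ i, x = t i
  · obtain ⟨i, rfl⟩ := h
    right
    rw [eval_derivative_polyU]
    exact eval_polyUErase_ne_zero ht i
  · left
    push Not at h
    rw [polyU, eval_mul, eval_prod, eval_prod]
    refine mul_ne_zero (Finset.prod_ne_zero_iff.2 fun i _ => ?_)
      (Finset.prod_ne_zero_iff.2 fun l _ => ?_)
    · simpa [sub_eq_zero] using h i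
    · simpa using fun h' => absurd (sub_eq_zero.1 h') (hx l)

/-- If `P` is not a Wronskian of `U`, then the generic solution is multivalued. -/
theorem genericSolutionMultivalued_of_wronskian_ne {b n : ℕ} {z : Fin n → ℂ} {m : Fin n → ℕ}
    {a : Fin n} {t : Fin b → ℂ} (hz : Function.Injective z)
    (ht : IsCriticalPoint z (tildeExponents m a) t) {H : ℂ[X]} (hH : IsAssociated z m a t H)
    (hne : ∀ V : ℂ[X], wronskian (polyU z m a t) V ≠ polyP z m) :
    GenericSolutionMultivalued (polyF z) (polyG z m) H := by
  intro x₀ hx₀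
  set U := polyU z m a t with hU
  obtain ⟨V, r, hPV⟩ := exists_polyP_eq hz ht
  obtain ⟨l₀, hl₀, hr⟩ : ∃ l ∈ Finset.Ici a, r l ≠ 0 := by
    by_contra! h
    refine hne V ?_
    rw [hPV, Finset.sum_eq_zero fun l hl => by rw [h l hl, C_0, zero_mul], mul_zero, add_zero]
  -- The exceptional set is the line of initial values whose Wronskian with `U` at `x₀` vanishes.
  -- The form is nonzero since `U` has no multiple root off the `z l`.
  refine ⟨MvPolynomial.C (U.eval x₀) * MvPolynomial.X 1 -
    MvPolynomial.C ((derivative U).eval x₀) * MvPolynomial.X 0, ?_, ?_⟩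
  · intro h0
    have h1 := congrArg (MvPolynomial.eval ![0, 1]) h0
    have h2 := congrArg (MvPolynomial.eval ![1, 0]) h0
    simp at h1 h2
    exact (eval_polyU_ne_zero_or (m := m) (a := a) ht.1 (eval_polyF_ne_zero.1 hx₀)).elim
      (fun h => h h1) fun h => h h2
  · intro u hu hW
    refine isMultivalued_of_residue_ne_zero (s := Finset.Ici a) (r := r) (P := polyP z m) hz
      polyU_ne_zero hH.2 (polyF_mul_derivative_polyP z m) (fun _ => eval_polyF_ne_zero)
      (fun _ => eval_polyP_ne_zero) (fun l => U /ₘ (X - C (z l))) (fun l hl => ?_) hPV hl₀ hr hx₀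
      hu (by simpa using hW)
    rw [mul_comm, mul_divByMonic_eq_iff_isRoot, IsRoot.def, hU, polyU, eval_mul, eval_prod,
      eval_prod]
    exact mul_eq_zero_of_right _ (Finset.prod_eq_zero hl (by simp))

end SchVar

theorem mainTheorem9 (n k b : ℕ) (m : Fin n → ℕ) (a : Fin n) (hm : ∀ l, 0 < m l)
    (hk : (k : ℤ) < (∑ l, (m l : ℤ)) + 1 - k)
    (hb : 0 < b) (hkb : (b : ℤ) = k - ∑ l ∈ Finset.Ici a, ((m l : ℤ) + 1)) :
    ∃ S : ℝ, ∀ s : ℝ, S < s → ∀ t : Fin b → ℂ,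
      SchVar.IsCriticalPoint (SchVar.zPoint n s) (SchVar.tildeExponents m a) t →
        (∃! H : Polynomial ℂ, SchVar.IsAssociated (SchVar.zPoint n s) m a t H) ∧
        ∀ H : Polynomial ℂ, SchVar.IsAssociated (SchVar.zPoint n s) m a t H →
          SchVar.GenericSolutionMultivalued
            (SchVar.polyF (SchVar.zPoint n s)) (SchVar.polyG (SchVar.zPoint n s) m) H := by
  obtain ⟨n, rfl⟩ := Nat.exists_eq_succ_of_ne_zero a.pos.ne'
  have hkb' : b + ∑ l ∈ Finset.Ici a, (m l + 1) = k := by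
    zify
    linarith
  have hkm : k + k < ∑ l, m l + 1 := by
    zify
    linarith
  obtain ⟨S, hS⟩ := SchVar.exists_forall_wronskian_ne m (by omega) hkm
  -- `s > 1` makes the powers of `s` distinct.
  refine ⟨max S 1, fun s hs t ht => ?_⟩
  have hz := SchVar.zPoint_injective (n + 1) ((le_max_right S 1).trans_lt hs)
  refine ⟨SchVar.existsUnique_isAssociated hz hm hb ht, fun H hH =>
    SchVar.genericSolutionMultivalued_of_wronskian_ne hz ht hH fun V => ?_⟩
  refine hS s ((le_max_left S 1).trans_lt hs) _ V (SchVar.natDegree_polyU.trans hkb') ?_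
  -- The last index is always among those `≥ a`, so `U` vanishes to order `m_n + 1` at the last
  -- point.
  exact (Finset.dvd_prod_of_mem _ (Finset.mem_Ici.2 (Fin.le_last a))).mul_left _
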